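/- Let $I=[\alpha,\beta]$ with $\alpha<\beta$, and let $\operatorname{ess\,inf}$, $\|\cdot\|_\infty$ and $\operatorname{var}$ denote the essential infimum, the essential supremum norm and the variation (the least variation among a.e.-equal functions) on $I$ with respect to Lebesgue measure. **Setting.** Let $\Omega$ be a Borel subset of a separable complete metric space, $m$ a Borel probability measure on $\Omega$, and $\sigma:\Omega\to\Omega$ an ergodic, $m$-preserving homeomorphism. A *random closed map* $\{T_\omega\}$ is given by a countable partition $\Omega=\bigcup_j\Omega_j$ into $m$-measurable sets and maps $T_j:I\to I$, with $T_\omega=T_j$ for $\omega\in\Omega_j$, such that for each $j$ there is a finite partition of $I$ (mod Lebesgue) into intervals on which $T_j$ is continuous and strictly monotone. Let $\mathcal Z(T_j)$ be the monotonicity partition of $T_j$, i.e. the collection of maximal open intervals on which $T_j$ is continuous and strictly monotone. An open interval $Z$ on which a map $F$ is continuous and strictly monotone is called *full* for $F$ if $F(Z)\supseteq(\alpha,\beta)$; every $T_j$ is assumed to have a full $Z\in\mathcal Z(T_j)$. Write $T_\omega^{(n)}=T_{\sigma^{n-1}\omega}\circ\cdots\circ T_\omega$, and let $\mathcal Z_\omega^{(n)}$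 be its monotonicity partition, consisting of the nonempty intersections $\bigcap_{i<n}(T_\omega^{(i)})^{-1}Z_i$ with $Z_i\in\mathcal Z(T_{\sigma^i\omega})$. Let $b_\omega^{(n)}$ be the number of $Z\in\mathcal Z_\omega^{(n)}$ that are full for $T_\omega^{(n)}$, and $\xi_\omega^{(n)}$ the largest size of a collection of non-full elements of $\mathcal Z_\omega^{(n)}$ whose union has a convex hull containing no full element. Given weights $g_j:I\to(0,\infty)$ of bounded variation, put $g_\omega=g_j$ for $\omega\in\Omega_j$, $g_\omega^{(n)}=\prod_{i<n}g_{\sigma^i\omega}\circ T_\omega^{(i)}$, let $$\mathcal L_\omega f=\sum_{Z\in\mathcal Z(T_\omega)}\mathbf 1_{T_\omega(Z)}\cdot\big((f g_\omega)\circ (T_\omega|_Z)^{-1}\big),\qquad \mathcal L_\omega^{(n)}=\mathcal L_{\sigma^{n-1}\omega}\circ\cdots\circ\mathcal L_\omega ,$$ and $$c_{\omega,n}=\Big(3+3\sum_{i<n}\frac{\operatorname{var}(g_{\sigma^i\omega})}{\|g_{\sigma^i\omega}\|_\infty}\Big)\,(1+2\xi_\omega^{(n)})\,\frac{\prod_{i<n}\|g_{\sigma^i\omega}\|_\infty}{\operatorname{ess\,inf}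 g_\omega^{(n)}}\cdot\frac1{b_\omega^{(n)}} .$$ The random potential $\{\log g_\omega\}$ is *strongly contracting* if $\log\#\mathcal Z(T_\omega)$, $\log\|g_\omega\|_\infty$, $\log\operatorname{ess\,inf} g_\omega$ and $\operatorname{var}(g_\omega)/\|g_\omega\|_\infty$ belong to $L^1(m)$ and $\int\log c_{\omega,n_*}\,dm<0$ for some $n_*>0$. **Lemma.** Suppose that each $T_j$ has a nonzero derivative at all but countably many points of $I$, that the weights $g_j=1/|T_j'|$ are of bounded variation, and that the geometric potential $\{\log g_\omega\}=\{-\log|T_\omega'|\}$ is strongly contracting. Then $\{T_\omega\}$ is covering: for $m$-a.e. $\omega$ and every nonempty open interval $J\subset I$ there is an integer $M=M_\omega(J)\ge1$ with $$\operatorname{ess\,inf}\,\mathcal L_\omega^{(M)}\mathbf 1_J>0 .$$ Moreover, for $m$-a.e. $\omega$ and every such $J$ there is an $M\ge1$ for which $T_\omega^{(M)}(J)$ is all of $I$ except for at most finitely many points. -/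

import Mathlib

open MeasureTheory Set
open scoped ENNReal

noncomputable section

namespace RandomInterval

/-! ### Functions on the compact interval `I = [α, β]`
Functions and maps on `I` are represented by functions `ℝ → ℝ`; only their values on `I` matter. -/

/-- Lebesgue measure on `I = [α, β]`. -/
def leb (α β : ℝ) : Measure ℝ := volume.restrict (Icc α β)

/-- The essential supremum norm on `I`. -/
def supNorm (α β : ℝ) (g : ℝ → ℝ) : ℝ := essSup (fun x => |g x|) (leb α β)

/-- The essential infimum on `I`. -/
def einf (α β : ℝ) (g : ℝ → ℝ) : ℝ := essInf g (leb α β)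

/-- The variation over `I` of the Lebesgue class of `g`: the least variation of a function that
coincides with `g` almost everywhere on `I`. -/
def essVar (α β : ℝ) (g : ℝ → ℝ) : ℝ≥0∞ :=
  ⨅ (h : ℝ → ℝ) (_ : h =ᵐ[leb α β] g), eVariationOn h (Icc α β)

/-- A weight on `I`: a positive function of bounded variation (up to Lebesgue null sets). -/
def IsWeight (α β : ℝ) (g : ℝ → ℝ) : Prop :=
  (∀ x ∈ Icc α β, 0 < g x) ∧ essVar α β g ≠ ∞

/-! ### Piecewise monotone maps and their branches -/

/-- There is a finite partition of `I` (up to a Lebesgue null set) into intervals, on each of which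
`F` is continuous and strictly monotone. -/
def IsPiecewiseMonotone (α β : ℝ) (F : ℝ → ℝ) : Prop :=
  ∃ P : Set (Set ℝ), P.Finite ∧ P.PairwiseDisjoint id ∧
    volume (Icc α β \ ⋃₀ P) = 0 ∧
    ∀ Z ∈ P, Z ⊆ Icc α β ∧ Z.OrdConnected ∧ ContinuousOn F Z ∧
      (StrictMonoOn F Z ∨ StrictAntiOn F Z)

/-- `Z` is a nonempty open subinterval of `I` on which `F` is continuous and strictly monotone. -/
def IsMonotonicityInterval (α β : ℝ) (F : ℝ → ℝ) (Z : Set ℝ) : Prop :=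
  Z.Nonempty ∧ IsOpen Z ∧ Z.OrdConnected ∧ Z ⊆ Icc α β ∧ ContinuousOn F Z ∧
    (StrictMonoOn F Z ∨ StrictAntiOn F Z)

/-- The monotonicity partition of `F` (a partition of `I` up to a Lebesgue null set): the maximal
open intervals on which `F` is continuous and strictly monotone. -/
def monotonicityPartition (α β : ℝ) (F : ℝ → ℝ) : Set (Set ℝ) :=
  {Z | Maximal (IsMonotonicityInterval α β F) Z}

/-- The elements of a partition `P` (into open intervals on which `F` is continuous and strictly
monotone) with full image. The images are open intervals as well, and full means that the image
contains the interior of `I`. -/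
def fullBranches (α β : ℝ) (F : ℝ → ℝ) (P : Set (Set ℝ)) : Set (Set ℝ) :=
  {Z ∈ P | Ioo α β ⊆ F '' Z}

/-- The elements of the partition `P` with non-full image. -/
def partialBranches (α β : ℝ) (F : ℝ → ℝ) (P : Set (Set ℝ)) : Set (Set ℝ) :=
  {Z ∈ P | ¬ Ioo α β ⊆ F '' Z}

/-- A finite collection of non-full intervals is contiguous if the convex hull of its union contains
no full one. -/
def IsContiguous (α β : ℝ) (F : ℝ → ℝ) (P : Set (Set ℝ)) (C : Finset (Set ℝ)) : Prop :=
  (∀ Z ∈ C, Z ∈ partialBranches α β F P) ∧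
    ∀ W ∈ fullBranches α β F P, ¬ W ⊆ convexHull ℝ (⋃ Z ∈ C, Z)

/-- The largest number of contiguous non-full intervals. -/
def maxContiguous (α β : ℝ) (F : ℝ → ℝ) (P : Set (Set ℝ)) : ℕ :=
  sSup {k | ∃ C : Finset (Set ℝ), IsContiguous α β F P C ∧ C.card = k}

/-- The transfer operator of `F` with weight `g`:
`f ↦ ∑_Z 1_{F(Z)} · ((f g) ∘ (F|_Z)⁻¹)`, the sum over the monotonicity partition of `F`. -/
def transfer (α β : ℝ) (F g f : ℝ → ℝ) (y : ℝ) : ℝ :=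
  ∑ᶠ Z ∈ monotonicityPartition α β F,
    (F '' Z).indicator (fun y => f (Function.invFunOn F Z y) * g (Function.invFunOn F Z y)) y

/-- The weight `1 / |F'|`, whose logarithm is the geometric potential `- log |F'|`. -/
def geometricWeight (F : ℝ → ℝ) (x : ℝ) : ℝ := Real.exp (-Real.log |deriv F x|)

/-- `F` has a nonzero derivative at all but countably many points of `I`, so that its geometric
potential is defined there. -/
def HasGeometricPotential (α β : ℝ) (F : ℝ → ℝ) : Prop :=
  {x ∈ Icc α β | ¬ (DifferentiableAt ℝ F x ∧ deriv F x ≠ 0)}.Countable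

/-! ### Random closed maps -/

/-- A random closed map of `I = [α, β]` over `(Ω, m)`: countably many piecewise monotone maps
`map 0, map 1, …` of `I`, each with a full branch, and a countable partition of `Ω` into measurable
sets (for the completion of `m`), on the `j`-th of which the map is `map j`. -/
structure RandomClosedMap (α β : ℝ) {Ω : Type*} [MeasurableSpace Ω] (m : Measure Ω) where
  /-- the index of the partition element that contains `ω` -/
  index : Ω → ℕ
  index_measurable : ∀ j, NullMeasurableSet (index ⁻¹' {j}) m
  /-- the countably many maps -/
  map : ℕ → ℝ → ℝ
  mapsTo : ∀ j, MapsTo (map j) (Icc α β) (Icc α β)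
  piecewiseMonotone : ∀ j, IsPiecewiseMonotone α β (map j)
  full_branch : ∀ j,
    (fullBranches α β (map j) (monotonicityPartition α β (map j))).Nonempty

namespace RandomClosedMap

variable {α β : ℝ} {Ω : Type*} [MeasurableSpace Ω] {m : Measure Ω}

/-- The map `T_ω`. -/
def T (R : RandomClosedMap α β m) (ω : Ω) : ℝ → ℝ := R.map (R.index ω)

/-- `T_ω^{(n)} = T_{σ^{n-1} ω} ∘ ⋯ ∘ T_{σ ω} ∘ T_ω`. -/
def iter (R : RandomClosedMap α β m) (σ : Ω → Ω) : ℕ → Ω → ℝ → ℝ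
  | 0, _ => id
  | n + 1, ω => R.T (σ^[n] ω) ∘ R.iter σ n ω

/-- The monotonicity partition of `T_ω^{(n)}` (up to a null set, for `n ≥ 1`): the nonempty
intersections `⋂_{i < n} (T_ω^{(i)})⁻¹ Z_i` with `Z_i` in the monotonicity partition of
`T_{σ^i ω}`. -/
def partition (R : RandomClosedMap α β m) (σ : Ω → Ω) (n : ℕ) (ω : Ω) : Set (Set ℝ) :=
  {W | W.Nonempty ∧ ∃ Z : ℕ → Set ℝ,
    (∀ i < n, Z i ∈ monotonicityPartition α β (R.T (σ^[i] ω))) ∧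
    W = Icc α β ∩ ⋂ i < n, R.iter σ i ω ⁻¹' Z i}

/-- The weight `g_ω`, for weights `g 0, g 1, …` with the same indexing as the maps. -/
def weight (R : RandomClosedMap α β m) (g : ℕ → ℝ → ℝ) (ω : Ω) : ℝ → ℝ := g (R.index ω)

/-- `g_ω^{(n)} = ∏_{i < n} g_{σ^i ω} ∘ T_ω^{(i)}`, the weight of the `n`-step transfer operator. -/
def weightIter (R : RandomClosedMap α β m) (σ : Ω → Ω) (g : ℕ → ℝ → ℝ) (n : ℕ) (ω : Ω) (x : ℝ) :
    ℝ :=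
  ∏ i ∈ Finset.range n, R.weight g (σ^[i] ω) (R.iter σ i ω x)

/-- `L_ω^{(n)} = L_{σ^{n-1} ω} ∘ ⋯ ∘ L_ω`, with `L_ω` the transfer operator of `T_ω` with weight
`g_ω`. -/
def transferIter (R : RandomClosedMap α β m) (σ : Ω → Ω) (g : ℕ → ℝ → ℝ) :
    ℕ → Ω → (ℝ → ℝ) → ℝ → ℝ
  | 0, _, f => f
  | n + 1, ω, f =>
    transfer α β (R.T (σ^[n] ω)) (R.weight g (σ^[n] ω)) (R.transferIter σ g n ω f)

/-- The quotient `var(g_ω) / ‖g_ω‖_∞`. -/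
def varRatio (R : RandomClosedMap α β m) (g : ℕ → ℝ → ℝ) (ω : Ω) : ℝ :=
  (essVar α β (R.weight g ω)).toReal / supNorm α β (R.weight g ω)

/-- The coefficient
`c_{ω,n} = (3 + 3 ∑_{i<n} var(g_{σ^i ω}) / ‖g_{σ^i ω}‖_∞) (1 + 2 ξ_ω^{(n)})
  (∏_{i<n} ‖g_{σ^i ω}‖_∞) / (b_{ω,f}^{(n)} · ess inf g_ω^{(n)})`,
where `ξ_ω^{(n)}` is the largest number of contiguous non-full intervals and `b_{ω,f}^{(n)}` the
number of full branches of `T_ω^{(n)}`. -/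
def contractionCoeff (R : RandomClosedMap α β m) (σ : Ω → Ω) (g : ℕ → ℝ → ℝ) (n : ℕ) (ω : Ω) : ℝ :=
  (3 + 3 * ∑ i ∈ Finset.range n, R.varRatio g (σ^[i] ω)) *
    (1 + 2 * (maxContiguous α β (R.iter σ n ω) (R.partition σ n ω) : ℝ)) *
    ((∏ i ∈ Finset.range n, supNorm α β (R.weight g (σ^[i] ω))) /
      einf α β (R.weightIter σ g n ω)) *
    (1 / ((fullBranches α β (R.iter σ n ω) (R.partition σ n ω)).ncard : ℝ))

/-- The random potential `log g_ω` is strongly contracting. Positivity of `ess inf g_ω` expresses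
that `log (ess inf g_ω)` is finite. -/
structure StronglyContracting (R : RandomClosedMap α β m) (σ : Ω → Ω) (g : ℕ → ℝ → ℝ) : Prop where
  isWeight : ∀ j, IsWeight α β (g j)
  integrable_log_card :
    Integrable (fun ω => Real.log ((monotonicityPartition α β (R.T ω)).ncard : ℝ)) m
  integrable_log_supNorm : Integrable (fun ω => Real.log (supNorm α β (R.weight g ω))) m
  einf_pos : ∀ᵐ ω ∂m, 0 < einf α β (R.weight g ω)
  integrable_log_einf : Integrable (fun ω => Real.log (einf α β (R.weight g ω))) m
  integrable_varRatio : Integrable (R.varRatio g) m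
  /-- The integral is an integral of an integrable function, being nonzero. -/
  contracting : ∃ n : ℕ, 0 < n ∧ ∫ ω, Real.log (R.contractionCoeff σ g n ω) ∂m < 0

/-- The random map is covering (with respect to the weights `g`): for almost every `ω`, every
nonempty open interval `J = (a, b) ⊆ I` has an `M` with `ess inf L_ω^{(M)} 1_J > 0`. -/
def IsCovering (R : RandomClosedMap α β m) (σ : Ω → Ω) (g : ℕ → ℝ → ℝ) : Prop :=
  ∀ᵐ ω ∂m, ∀ a b : ℝ, α ≤ a → a < b → b ≤ β →
    ∃ M : ℕ, 0 < M ∧ 0 < einf α β (R.transferIter σ g M ω ((Ioo a b).indicator 1))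

/-- The random map is covering in the sense of images: for almost every `ω`, every nonempty open
interval `J = (a, b) ⊆ I` has an `M` such that `T_ω^{(M)} J` is all of `I`, but for finitely many
points (the values at the endpoints of branches being arbitrary). -/
def IsImageCovering (R : RandomClosedMap α β m) (σ : Ω → Ω) : Prop :=
  ∀ᵐ ω ∂m, ∀ a b : ℝ, α ≤ a → a < b → b ≤ β →
    ∃ M : ℕ, 0 < M ∧ (Icc α β \ (R.iter σ M ω '' Ioo a b)).Finite

end RandomClosedMap

end RandomInterval

end

noncomputable section

namespace RandomInterval

/-! ### Birkhoff sums of functions with negative integral -/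

/-! Fix a generic ω and an interval J, and suppose that no image of J under an iterate contains (α,
β). Let u_l be the supremum of the lengths of open intervals inside T_ω^{(l)}(J), and let n be the
time with ∫ log c_{ω,n} < 0. An open interval J' inside T_ω^{(l)}(J) cannot contain a full branch of
the next n steps, so it meets at most ξ + 2 elements of their monotonicity partition: at most ξ lie
inside J', and each endpoint of J' lies in at most one element. On each element the n-step map
shrinks distances by at most the factor 1/∏‖g‖_∞, so |J'| ≤ (ξ + 2) ∏‖g‖_∞ · u_{l+n}.

The full branches are disjoint and each has length at least ess inf g^{(n)} · |I|. Hence b · ess inf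
g^{(n)} ≤ 1, and (ξ + 2) ∏‖g‖_∞ ≤ c (`IsBounded.le_contractionCoeff`). This gives u_l ≤ c_{σ^l ω,n}
u_{l+n} for every l.

Take logarithms and sum over all l < k, not only over multiples of n. The left side telescopes to
two blocks of n terms, and u ≤ β - α, so the Birkhoff sums of log c under σ itself are bounded
below; ergodicity of σ^n is never needed. But by ergodicity the Birkhoff sums of an integrable
function of negative integral are almost surely unbounded below (`not_bddBelow_birkhoffSum`), a
contradiction. So some T_ω^{(M)}(J) contains (α, β) (`exists_Ioo_subset_image_iter`).

For the transfer operator, keep only the term of a single orbit starting in J: off a countable set,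
L_ω^{(M)} 1_J ≥ ∏ ess inf g on T_ω^{(M)}(J). The derivative hypothesis enters through the
fundamental theorem of calculus, which turns bounds on 1/|T'| into bounds on distances within
branches. -/

theorem bddBelow_birkhoffSum_iff {Ω : Type*} (σ : Ω → Ω) (f : Ω → ℝ) (ω : Ω) :
    BddBelow (range fun k => birkhoffSum σ f k (σ ω)) ↔
      BddBelow (range fun k => birkhoffSum σ f k ω) := by
  constructor
  · rintro ⟨b, hb⟩
    refine ⟨min 0 (f ω + b), ?_⟩
    rintro _ ⟨k, rfl⟩
    cases k with
    | zero => simp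
    | succ k =>
      have := hb ⟨k, rfl⟩
      simp only [birkhoffSum_succ'] at this ⊢
      exact (min_le_right _ _).trans (by linarith)
  · rintro ⟨b, hb⟩
    refine ⟨b - f ω, ?_⟩
    rintro _ ⟨k, rfl⟩
    have := hb ⟨k + 1, rfl⟩
    simp only [birkhoffSum_succ'] at this ⊢
    linarith

theorem iInf_birkhoffSum_eq {Ω : Type*} (σ : Ω → Ω) (f : Ω → ℝ) (ω : Ω)
    (h : BddBelow (range fun k => birkhoffSum σ f k ω)) :
    ⨅ k, birkhoffSum σ f k ω = min 0 (f ω + ⨅ k, birkhoffSum σ f k (σ ω)) := by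
  have h' := (bddBelow_birkhoffSum_iff σ f ω).2 h
  apply le_antisymm
  · refine le_min ((ciInf_le h 0).trans (by simp)) ?_
    rw [← sub_le_iff_le_add']
    refine le_ciInf fun k => ?_
    have := ciInf_le h (k + 1)
    rw [birkhoffSum_succ'] at this
    linarith
  · refine le_ciInf fun k => ?_
    cases k with
    | zero => simp
    | succ k =>
      have := ciInf_le h' k
      rw [birkhoffSum_succ']
      exact (min_le_right _ _).trans (by linarith)

/-- `F` need not be integrable. Its truncations at ±N are, and their coboundaries integrate to zero
by invariance; a domination argument passes to the limit. -/
theorem integral_sub_comp_eq_zero {Ω : Type*} [MeasurableSpace Ω] {m : Measure Ω}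
    [IsProbabilityMeasure m] {σ : Ω → Ω} (hσ : MeasurePreserving σ m m) {F f : Ω → ℝ}
    (hF : Measurable F) (hf : Integrable f m) (h : ∀ᵐ ω ∂m, |F ω - F (σ ω)| ≤ |f ω|) :
    ∫ ω, (F ω - F (σ ω)) ∂m = 0 := by
  set G : ℕ → Ω → ℝ := fun N ω => max (min (F ω) N) (-N)
  have hGm : ∀ N, Measurable (G N) := fun N => (hF.min measurable_const).max measurable_const
  have hGi : ∀ N, Integrable (G N) m := fun N =>
    Integrable.of_bound (hGm N).aestronglyMeasurable N (Filter.Eventually.of_forall fun ω => by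
      simp only [G, Real.norm_eq_abs, abs_le]
      have : (0 : ℝ) ≤ N := Nat.cast_nonneg N
      exact ⟨le_max_right _ _, max_le (min_le_right _ _) (by linarith)⟩)
  have hzero : ∀ N, ∫ ω, (G N ω - G N (σ ω)) ∂m = 0 := by
    intro N
    have := integral_sub (hGi N) (hσ.integrable_comp_of_integrable (hGi N))
    simp only [Function.comp_apply] at this
    rw [this,
      ← integral_map hσ.measurable.aemeasurable (by
        rw [hσ.map_eq]; exact (hGm N).aestronglyMeasurable), hσ.map_eq, sub_self]
  have hlim : Filter.Tendsto (fun N => ∫ ω, (G N ω - G N (σ ω)) ∂m) Filter.atTop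
      (nhds (∫ ω, (F ω - F (σ ω)) ∂m)) := by
    -- Truncation is 1-Lipschitz, so the truncated differences are still dominated by |f|.
    refine tendsto_integral_of_dominated_convergence (fun ω => |f ω|)
      (fun N => ((hGm N).sub ((hGm N).comp hσ.measurable)).aestronglyMeasurable) hf.abs
      (fun N => ?_) (Filter.Eventually.of_forall fun ω => ?_)
    · filter_upwards [h] with ω hω
      refine le_trans ?_ hω
      simp only [G, Real.norm_eq_abs]
      exact (abs_max_sub_max_le_abs _ _ _).trans (abs_min_sub_min_le_max _ _ _ _ |>.trans
        (by simp))
    · have key : ∀ x, Filter.Tendsto (fun N => G N x) Filter.atTop (nhds (F x)) := by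
        intro x
        obtain ⟨N, hN⟩ := exists_nat_ge |F x|
        refine tendsto_const_nhds.congr' ?_
        filter_upwards [Filter.eventually_ge_atTop N] with M hM
        have hM' : (N : ℝ) ≤ M := by exact_mod_cast hM
        have := abs_le.1 (hN.trans hM')
        simp only [G]
        rw [min_eq_left this.2, max_eq_left this.1]
      exact (key ω).sub (key (σ ω))
  simp only [hzero] at hlim
  exact tendsto_nhds_unique hlim tendsto_const_nhds

/-- The set where the sums are bounded below is invariant, hence null or full. If it were full,
their infimum F would be finite with F = min(0, f + F∘σ). Then F - F∘σ ≤ f while the left side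
integrates to zero, which contradicts ∫ f < 0. -/
theorem not_bddBelow_birkhoffSum_of_measurable {Ω : Type*} [MeasurableSpace Ω] {m : Measure Ω}
    [IsProbabilityMeasure m] {σ : Ω → Ω} (hσ : Ergodic σ m) {f : Ω → ℝ} (hfm : Measurable f)
    (hf : Integrable f m) (hneg : ∫ ω, f ω ∂m < 0) :
    ∀ᵐ ω ∂m, ¬ BddBelow (range fun k => birkhoffSum σ f k ω) := by
  have hS : ∀ k, Measurable (birkhoffSum σ f k) := fun k => by
    unfold birkhoffSum
    exact Finset.measurable_sum _ fun i _ => hfm.comp (hσ.measurable.iterate i)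
  have hA := measurableSet_bddBelow_range hS
  rcases hσ.toPreErgodic.ae_empty_or_univ hA
    (by ext ω; exact bddBelow_birkhoffSum_iff σ f ω) with h | h
  · filter_upwards [h] with ω hω hb
    exact (iff_of_eq hω).1 hb
  exfalso
  have hb : ∀ᵐ ω ∂m, BddBelow (range fun k => birkhoffSum σ f k ω) := by
    filter_upwards [h] with ω hω using (iff_of_eq hω).2 trivial
  set F : Ω → ℝ := fun ω => ⨅ k, birkhoffSum σ f k ω
  have hFm : Measurable F := Measurable.iInf hS
  have hD : ∀ᵐ ω ∂m, F ω - F (σ ω) = min (-F (σ ω)) (f ω) ∧ F (σ ω) ≤ 0 := by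
    filter_upwards [hb] with ω hω
    have h1 := iInf_birkhoffSum_eq σ f ω hω
    have h2 : F (σ ω) ≤ 0 :=
      (ciInf_le ((bddBelow_birkhoffSum_iff σ f ω).2 hω) 0).trans (by simp)
    refine ⟨?_, h2⟩
    change F ω = min 0 (f ω + F (σ ω)) at h1
    rw [h1, ← min_sub_sub_right]
    simp
  have habs : ∀ᵐ ω ∂m, |F ω - F (σ ω)| ≤ |f ω| := by
    filter_upwards [hD] with ω ⟨h1, h2⟩
    rw [h1]
    rcases min_cases (-F (σ ω)) (f ω) with ⟨h, h'⟩ | ⟨h, h'⟩ <;> rw [h]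
    rw [abs_of_nonneg (by linarith)]
    exact h'.trans (le_abs_self _)
  have h0 := integral_sub_comp_eq_zero hσ.toMeasurePreserving hFm hf habs
  have hint : Integrable (fun ω => F ω - F (σ ω)) m :=
    hf.mono (hFm.sub (hFm.comp hσ.measurable)).aestronglyMeasurable habs
  have : ∫ ω, (F ω - F (σ ω)) ∂m ≤ ∫ ω, f ω ∂m := by
    refine integral_mono_ae hint hf ?_
    filter_upwards [hD] with ω ⟨h1, _⟩
    rw [h1]; exact min_le_right _ _
  linarith

/-- The Birkhoff sums of an integrable function with negative integral are unbounded below. -/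
theorem not_bddBelow_birkhoffSum {Ω : Type*} [MeasurableSpace Ω] {m : Measure Ω}
    [IsProbabilityMeasure m] {σ : Ω → Ω} (hσ : Ergodic σ m) {f : Ω → ℝ}
    (hf : Integrable f m) (hneg : ∫ ω, f ω ∂m < 0) :
    ∀ᵐ ω ∂m, ¬ BddBelow (range fun k => birkhoffSum σ f k ω) := by
  obtain ⟨f', hf'm, hff'⟩ := hf.1
  have hm := hf'm.measurable
  have := not_bddBelow_birkhoffSum_of_measurable hσ hm (hf.congr hff')
    (by rwa [← integral_congr_ae hff'])
  have h2 : ∀ᵐ ω ∂m, ∀ k, f (σ^[k] ω) = f' (σ^[k] ω) :=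
    ae_all_iff.2 fun k =>
      ((hσ.toMeasurePreserving.iterate k).quasiMeasurePreserving).ae hff'
  filter_upwards [this, h2] with ω h1 h2
  convert h1 using 4 with k
  exact Finset.sum_congr rfl fun i _ => h2 i

section

/-! ### The monotonicity partition -/

theorem exists_lt_of_isOpen {U : Set ℝ} (hU : IsOpen U) (hne : U.Nonempty) :
    ∃ x ∈ U, ∃ y ∈ U, x < y := by
  obtain ⟨x, hx⟩ := hne
  obtain ⟨ε, hε, h⟩ := Metric.isOpen_iff.1 hU x hx
  refine ⟨x, hx, x + ε / 2, h ?_, by linarith⟩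
  rw [Metric.mem_ball, Real.dist_eq, add_sub_cancel_left, abs_of_pos (by linarith)]
  linarith

theorem strictMonoOn_union {F : ℝ → ℝ} {Z₁ Z₂ : Set ℝ} (h₁ : StrictMonoOn F Z₁)
    (h₂ : StrictMonoOn F Z₂) (o₁ : Z₁.OrdConnected) (o₂ : Z₂.OrdConnected)
    (hne : (Z₁ ∩ Z₂).Nonempty) : StrictMonoOn F (Z₁ ∪ Z₂) := by
  obtain ⟨p, hp₁, hp₂⟩ := hne
  have key : ∀ {A B : Set ℝ}, StrictMonoOn F A → StrictMonoOn F B → A.OrdConnected →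
      B.OrdConnected → p ∈ A → p ∈ B → ∀ {x y}, x ∈ A → y ∈ B → x < y → F x < F y := by
    intro A B hA hB oA oB pA pB x y hx hy hxy
    rcases le_total p x with h | h
    · exact hB (oB.out pB hy ⟨h, hxy.le⟩) hy hxy
    rcases le_total y p with h' | h'
    · exact hA hx (oA.out hx pA ⟨hxy.le, h'⟩) hxy
    rcases h.eq_or_lt with rfl | h
    · exact hB pB hy hxy
    rcases h'.eq_or_lt with rfl | h'
    · exact hA hx pA hxy
    · exact (hA hx pA h).trans (hB pB hy h')
  rintro x (hx | hx) y (hy | hy) hxy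
  · exact h₁ hx hy hxy
  · exact key h₁ h₂ o₁ o₂ hp₁ hp₂ hx hy hxy
  · exact key h₂ h₁ o₂ o₁ hp₂ hp₁ hx hy hxy
  · exact h₂ hx hy hxy

theorem strictAntiOn_union {F : ℝ → ℝ} {Z₁ Z₂ : Set ℝ} (h₁ : StrictAntiOn F Z₁)
    (h₂ : StrictAntiOn F Z₂) (o₁ : Z₁.OrdConnected) (o₂ : Z₂.OrdConnected)
    (hne : (Z₁ ∩ Z₂).Nonempty) : StrictAntiOn F (Z₁ ∪ Z₂) := by
  have := strictMonoOn_union (F := fun x => -F x) (fun x hx y hy h => neg_lt_neg (h₁ hx hy h))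
    (fun x hx y hy h => neg_lt_neg (h₂ hx hy h)) o₁ o₂ hne
  exact fun x hx y hy h => neg_lt_neg_iff.1 (this hx hy h)

theorem not_strictMonoOn_of_strictAntiOn {F : ℝ → ℝ} {U A B : Set ℝ} (hU : IsOpen U)
    (hne : U.Nonempty) (hA : U ⊆ A) (hB : U ⊆ B) (h₁ : StrictMonoOn F A)
    (h₂ : StrictAntiOn F B) : False := by
  obtain ⟨x, hx, y, hy, hxy⟩ := exists_lt_of_isOpen hU hne
  exact lt_asymm (h₁ (hA hx) (hA hy) hxy) (h₂ (hB hx) (hB hy) hxy)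

variable {α β : ℝ} {F : ℝ → ℝ}

theorem IsMonotonicityInterval.union {Z₁ Z₂ : Set ℝ} (h₁ : IsMonotonicityInterval α β F Z₁)
    (h₂ : IsMonotonicityInterval α β F Z₂) (hne : (Z₁ ∩ Z₂).Nonempty) :
    IsMonotonicityInterval α β F (Z₁ ∪ Z₂) := by
  obtain ⟨n₁, op₁, o₁, s₁, c₁, m₁⟩ := h₁
  obtain ⟨n₂, op₂, o₂, s₂, c₂, m₂⟩ := h₂
  refine ⟨n₁.mono subset_union_left, op₁.union op₂, ?_, union_subset s₁ s₂,
    c₁.union_of_isOpen c₂ op₁ op₂, ?_⟩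
  · obtain ⟨p, hp₁, hp₂⟩ := hne
    exact (IsPreconnected.union p hp₁ hp₂ o₁.isPreconnected o₂.isPreconnected).ordConnected
  · rcases m₁ with m₁ | m₁ <;> rcases m₂ with m₂ | m₂
    · exact Or.inl (strictMonoOn_union m₁ m₂ o₁ o₂ hne)
    · exact (not_strictMonoOn_of_strictAntiOn (op₁.inter op₂) hne inter_subset_left
        inter_subset_right m₁ m₂).elim
    · exact (not_strictMonoOn_of_strictAntiOn (op₁.inter op₂) hne inter_subset_right
        inter_subset_left m₂ m₁).elim
    · exact Or.inr (strictAntiOn_union m₁ m₂ o₁ o₂ hne)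

theorem subset_of_mem_monotonicityPartition {Z Z' : Set ℝ}
    (hZ : Z ∈ monotonicityPartition α β F) (hZ' : IsMonotonicityInterval α β F Z')
    (hne : (Z ∩ Z').Nonempty) : Z' ⊆ Z :=
  subset_union_right.trans (hZ.2 (hZ.1.union hZ' hne) subset_union_left)

theorem eq_of_mem_monotonicityPartition {Z Z' : Set ℝ}
    (hZ : Z ∈ monotonicityPartition α β F) (hZ' : Z' ∈ monotonicityPartition α β F)
    (hne : (Z ∩ Z').Nonempty) : Z = Z' :=
  (subset_of_mem_monotonicityPartition hZ' hZ.1 (by rwa [inter_comm])).antisymm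
    (subset_of_mem_monotonicityPartition hZ hZ'.1 hne)

/-- The maximal interval is the union of all monotonicity intervals containing `Z`. Any two of its
points lie in a common member, and `Z` fixes the direction of monotonicity. -/
theorem exists_mem_monotonicityPartition {Z : Set ℝ} (hZ : IsMonotonicityInterval α β F Z) :
    ∃ W ∈ monotonicityPartition α β F, Z ⊆ W := by
  set S : Set (Set ℝ) := {Z' | IsMonotonicityInterval α β F Z' ∧ Z ⊆ Z'}
  have hZS : Z ∈ S := ⟨hZ, Subset.rfl⟩
  have hpair : ∀ {x y}, x ∈ ⋃₀ S → y ∈ ⋃₀ S → ∃ A ∈ S, x ∈ A ∧ y ∈ A := by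
    rintro x y ⟨A, hA, hx⟩ ⟨B, hB, hy⟩
    refine ⟨A ∪ B, ⟨hA.1.union hB.1 (hZ.1.mono (subset_inter hA.2 hB.2)),
      hA.2.trans subset_union_left⟩, Or.inl hx, Or.inr hy⟩
  have hM : IsMonotonicityInterval α β F (⋃₀ S) := by
    refine ⟨hZ.1.mono (subset_sUnion_of_mem hZS), isOpen_sUnion fun A hA => hA.1.2.1, ⟨?_⟩,
      sUnion_subset fun A hA => hA.1.2.2.2.1, ?_, ?_⟩
    · intro x hx y hy
      obtain ⟨A, hA, hxA, hyA⟩ := hpair hx hy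
      exact (hA.1.2.2.1.out hxA hyA).trans (subset_sUnion_of_mem hA)
    · rintro x ⟨A, hA, hx⟩
      exact ((hA.1.2.2.2.2.1).continuousAt (hA.1.2.1.mem_nhds hx)).continuousWithinAt
    · rcases hZ.2.2.2.2.2 with h | h
      · left
        intro x hx y hy hxy
        obtain ⟨A, hA, hxA, hyA⟩ := hpair hx hy
        rcases hA.1.2.2.2.2.2 with h' | h'
        · exact h' hxA hyA hxy
        · exact (not_strictMonoOn_of_strictAntiOn hZ.2.1 hZ.1 Subset.rfl hA.2 h h').elim
      · right
        intro x hx y hy hxy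
        obtain ⟨A, hA, hxA, hyA⟩ := hpair hx hy
        rcases hA.1.2.2.2.2.2 with h' | h'
        · exact (not_strictMonoOn_of_strictAntiOn hZ.2.1 hZ.1 hA.2 Subset.rfl h' h).elim
        · exact h' hxA hyA hxy
  exact ⟨⋃₀ S, ⟨hM, fun A hA h =>
    subset_sUnion_of_mem (⟨hA, (subset_sUnion_of_mem hZS).trans h⟩ : A ∈ S)⟩,
    subset_sUnion_of_mem hZS⟩

/-- Intervals have null frontier, so an open set missing every interior would be null. -/
theorem exists_inter_interior_nonempty {P : Set (Set ℝ)} (hfin : P.Finite)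
    (hnull : volume (Icc α β \ ⋃₀ P) = 0) (hord : ∀ Z ∈ P, Z.OrdConnected) {U : Set ℝ}
    (hU : IsOpen U) (hne : U.Nonempty) (hsub : U ⊆ Icc α β) :
    ∃ p ∈ P, (U ∩ interior p).Nonempty := by
  by_contra! hcon
  have h0 : volume (U ∩ ⋃₀ P) = 0 := by
    rw [sUnion_eq_biUnion, inter_iUnion₂]
    refine (measure_biUnion_null_iff hfin.countable).2 fun p hp => ?_
    refine measure_mono_null ?_ (Convex.addHaar_frontier volume (hord p hp).convex)
    rintro x ⟨hxU, hxp⟩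
    refine ⟨subset_closure hxp, fun hxi => ?_⟩
    exact notMem_empty x (hcon p hp ▸ ⟨hxU, hxi⟩)
  have : volume U = 0 := by
    refine measure_mono_null (t := (U ∩ ⋃₀ P) ∪ (Icc α β \ ⋃₀ P)) ?_ (measure_union_null h0 hnull)
    intro x hx
    by_cases h : x ∈ ⋃₀ P
    · exact Or.inl ⟨hx, h⟩
    · exact Or.inr ⟨hsub hx, h⟩
  exact (hU.measure_pos volume hne).ne' this

theorem isMonotonicityInterval_interior {p : Set ℝ} (hsub : p ⊆ Icc α β) (hord : p.OrdConnected)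
    (hcont : ContinuousOn F p) (hmono : StrictMonoOn F p ∨ StrictAntiOn F p)
    (hne : (interior p).Nonempty) : IsMonotonicityInterval α β F (interior p) :=
  ⟨hne, isOpen_interior, hord.interior, interior_subset.trans hsub, hcont.mono interior_subset,
    hmono.imp (fun h => h.mono interior_subset) (fun h => h.mono interior_subset)⟩

/-- Each maximal interval meets, and then by maximality contains, the interior of some piece of the
given finite partition. Disjointness makes this choice of piece injective. -/
theorem finite_monotonicityPartition (h : IsPiecewiseMonotone α β F) :
    (monotonicityPartition α β F).Finite := by
  obtain ⟨P, hfin, -, hnull, hP⟩ := h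
  have hex : ∀ Z ∈ monotonicityPartition α β F, ∃ p ∈ P, (Z ∩ interior p).Nonempty :=
    fun Z hZ => exists_inter_interior_nonempty hfin hnull (fun p hp => (hP p hp).2.1)
      hZ.1.2.1 hZ.1.1 hZ.1.2.2.2.1
  choose! f hfP hf using hex
  refine Set.Finite.of_injOn (f := f) (fun Z hZ => hfP Z hZ) ?_ hfin
  intro Z hZ Z' hZ' heq
  obtain ⟨h1, h2, h3, h4⟩ := hP _ (hfP Z hZ)
  have hi := isMonotonicityInterval_interior h1 h2 h3 h4 ((hf Z hZ).mono inter_subset_right)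
  have hs := subset_of_mem_monotonicityPartition hZ hi (hf Z hZ)
  have hs' := subset_of_mem_monotonicityPartition hZ' hi (heq ▸ hf Z' hZ')
  exact eq_of_mem_monotonicityPartition hZ hZ' (hi.1.mono (subset_inter hs hs'))

theorem finite_closure_diff {Z : Set ℝ} (hne : Z.Nonempty) (hord : Z.OrdConnected)
    (hsub : Z ⊆ Icc α β) : (closure Z \ Z).Finite := by
  have hb : BddBelow Z := bddBelow_Icc.mono hsub
  have ha : BddAbove Z := bddAbove_Icc.mono hsub
  have h1 := IsConnected.Ioo_csInf_csSup_subset ⟨hne, hord.isPreconnected⟩ hb ha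
  have h2 : closure Z ⊆ Icc (sInf Z) (sSup Z) :=
    closure_minimal (subset_Icc_csInf_csSup hb ha) isClosed_Icc
  refine (Set.toFinite {sInf Z, sSup Z}).subset ?_
  rintro x ⟨hx, hxZ⟩
  obtain ⟨hx1, hx2⟩ := h2 hx
  rcases hx1.eq_or_lt with h | h
  · exact Or.inl h.symm
  rcases hx2.eq_or_lt with h' | h'
  · exact Or.inr h'
  · exact (hxZ (h1 ⟨h, h'⟩)).elim

/-- A missed point is α, β or an endpoint of a maximal interval. Otherwise an open set around it
would avoid all maximal intervals, yet meet the interior of a given piece, which lies in one of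
them. -/
theorem finite_diff_monotonicityPartition (h : IsPiecewiseMonotone α β F) :
    (Icc α β \ ⋃₀ monotonicityPartition α β F).Finite := by
  have hM := finite_monotonicityPartition h
  have hfin : ({α, β} ∪ ⋃ Z ∈ monotonicityPartition α β F, closure Z \ Z).Finite :=
    (Set.toFinite _).union (hM.biUnion fun Z hZ =>
      finite_closure_diff hZ.1.1 hZ.1.2.2.1 hZ.1.2.2.2.1)
  refine hfin.subset ?_
  rintro x ⟨hxI, hx⟩
  by_cases hcl : x ∈ closure (⋃₀ monotonicityPartition α β F)
  · rw [hM.closure_sUnion] at hcl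
    obtain ⟨Z, hZ, hxZ⟩ := mem_iUnion₂.1 hcl
    exact Or.inr (mem_iUnion₂.2 ⟨Z, hZ, hxZ, fun h => hx ⟨Z, hZ, h⟩⟩)
  · left
    by_contra hends
    simp only [mem_insert_iff, mem_singleton_iff, not_or] at hends
    have hxo : x ∈ Ioo α β :=
      ⟨lt_of_le_of_ne hxI.1 (Ne.symm hends.1), lt_of_le_of_ne hxI.2 hends.2⟩
    obtain ⟨P, hPfin, -, hnull, hP⟩ := h
    obtain ⟨p, hp, y, ⟨hyI, hyc⟩, hyp⟩ := exists_inter_interior_nonempty hPfin hnull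
      (fun p hp => (hP p hp).2.1)
      (U := Ioo α β ∩ (closure (⋃₀ monotonicityPartition α β F))ᶜ)
      (isOpen_Ioo.inter isClosed_closure.isOpen_compl) ⟨x, hxo, hcl⟩
      (inter_subset_left.trans Ioo_subset_Icc_self)
    obtain ⟨h1, h2, h3, h4⟩ := hP p hp
    obtain ⟨W, hW, hpW⟩ := exists_mem_monotonicityPartition
      (isMonotonicityInterval_interior h1 h2 h3 h4 ⟨y, hyp⟩)
    exact hyc (subset_closure ⟨W, hW, hpW hyp⟩)

end

section

/-! ### Distortion of lengths by a map with geometric potential -/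

theorem geometricWeight_of_deriv_ne_zero {F : ℝ → ℝ} {x : ℝ} (h : deriv F x ≠ 0) :
    geometricWeight F x = |deriv F x|⁻¹ := by
  rw [geometricWeight, Real.exp_neg, Real.exp_log (abs_pos.2 h)]

theorem geometricWeight_pos (F : ℝ → ℝ) (x : ℝ) : 0 < geometricWeight F x := Real.exp_pos _

theorem geometricWeight_neg (F : ℝ → ℝ) : geometricWeight (-F) = geometricWeight F := by
  funext x
  simp [geometricWeight, deriv.neg]

variable {α β : ℝ} {F : ℝ → ℝ}

theorem HasGeometricPotential.neg (h : HasGeometricPotential α β F) :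
    HasGeometricPotential α β (-F) := by
  refine h.mono ?_
  rintro x ⟨hx, h'⟩
  refine ⟨hx, fun h2 => h' ⟨h2.1.neg, ?_⟩⟩
  simpa [deriv.neg] using h2.2

/-- The lower bound on the weight bounds F' and so makes it integrable; the fundamental theorem of
calculus then tolerates the countable exceptional set. Decreasing branches are handled later by
passing to -F. -/
theorem integral_deriv_eq_sub_of_strictMonoOn (hd : HasGeometricPotential α β F) {e x y : ℝ}
    (he : 0 < e) (hxy : x < y) (hsub : Icc x y ⊆ Icc α β) (hc : ContinuousOn F (Icc x y))
    (hm : StrictMonoOn F (Icc x y)) (hge : ∀ᵐ z ∂leb α β, e ≤ geometricWeight F z) :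
    IntervalIntegrable (deriv F) volume x y ∧ ∫ z in x..y, deriv F z = F y - F x ∧
      (∀ᵐ z ∂volume.restrict (Icc x y), deriv F z = |deriv F z| ∧ 0 < |deriv F z| ∧
        |deriv F z| ≤ e⁻¹) := by
  have hae : ∀ᵐ z ∂volume.restrict (Icc x y), deriv F z = |deriv F z| ∧ 0 < |deriv F z| ∧
        |deriv F z| ≤ e⁻¹ := by
    rw [← Measure.restrict_congr_set (Ioo_ae_eq_Icc (μ := volume))]
    have h1 : ∀ᵐ z ∂volume.restrict (Ioo x y), e ≤ geometricWeight F z :=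
      ae_restrict_of_ae_restrict_of_subset (Ioo_subset_Icc_self.trans hsub) hge
    have h2 : ∀ᵐ z ∂volume.restrict (Ioo x y), z ∉ {z ∈ Icc α β |
        ¬ (DifferentiableAt ℝ F z ∧ deriv F z ≠ 0)} :=
      ae_restrict_of_ae (measure_eq_zero_iff_ae_notMem.1 (hd.measure_zero volume))
    filter_upwards [h1, h2, ae_restrict_mem measurableSet_Ioo] with z hz1 hz2 hz
    have hz2 : DifferentiableAt ℝ F z ∧ deriv F z ≠ 0 := by
      by_contra h
      exact hz2 ⟨hsub (Ioo_subset_Icc_self hz), h⟩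
    refine ⟨(abs_of_nonneg ?_).symm, abs_pos.2 hz2.2, ?_⟩
    · rw [← derivWithin_of_isOpen isOpen_Ioo hz]
      exact (hm.monotoneOn.mono Ioo_subset_Icc_self).derivWithin_nonneg
    · rw [geometricWeight_of_deriv_ne_zero hz2.2] at hz1
      exact (le_inv_comm₀ he (abs_pos.2 hz2.2)).1 hz1
  have hint : IntervalIntegrable (deriv F) volume x y := by
    rw [intervalIntegrable_iff_integrableOn_Icc_of_le hxy.le]
    refine IntegrableOn.of_bound (by simp) (measurable_deriv F).aestronglyMeasurable e⁻¹ ?_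
    filter_upwards [hae] with z hz using hz.2.2
  refine ⟨hint, ?_, hae⟩
  refine integral_eq_of_hasDerivAt_off_countable_of_le F (deriv F) hxy.le hd hc ?_ hint
  rintro z ⟨hz, hz'⟩
  refine DifferentiableAt.hasDerivAt ?_
  by_contra h
  exact hz' ⟨hsub (Ioo_subset_Icc_self hz), fun h' => h h'.1⟩

theorem sub_le_of_strictMonoOn (hd : HasGeometricPotential α β F) {e x y : ℝ}
    (he : 0 < e) (hxy : x < y) (hsub : Icc x y ⊆ Icc α β) (hc : ContinuousOn F (Icc x y))
    (hm : StrictMonoOn F (Icc x y)) (hge : ∀ᵐ z ∂leb α β, e ≤ geometricWeight F z) :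
    e * (F y - F x) ≤ y - x := by
  obtain ⟨hi, heq, hae⟩ := integral_deriv_eq_sub_of_strictMonoOn hd he hxy hsub hc hm hge
  have : ∫ z in x..y, deriv F z ≤ ∫ _ in x..y, e⁻¹ := by
    refine intervalIntegral.integral_mono_ae_restrict hxy.le hi intervalIntegrable_const ?_
    filter_upwards [hae] with z hz
    rw [hz.1]; exact hz.2.2
  rw [heq, intervalIntegral.integral_const, smul_eq_mul] at this
  calc e * (F y - F x) ≤ e * ((y - x) * e⁻¹) := by gcongr
    _ = y - x := by field_simp

theorem le_sub_of_strictMonoOn (hd : HasGeometricPotential α β F) {e C x y : ℝ}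
    (he : 0 < e) (hxy : x < y) (hsub : Icc x y ⊆ Icc α β) (hc : ContinuousOn F (Icc x y))
    (hm : StrictMonoOn F (Icc x y)) (hge : ∀ᵐ z ∂leb α β, e ≤ geometricWeight F z)
    (hC : 0 < C) (hle : ∀ᵐ z ∂leb α β, geometricWeight F z ≤ C) :
    y - x ≤ C * (F y - F x) := by
  obtain ⟨hi, heq, hae⟩ := integral_deriv_eq_sub_of_strictMonoOn hd he hxy hsub hc hm hge
  have h1 : ∀ᵐ z ∂volume.restrict (Icc x y), geometricWeight F z ≤ C :=
      ae_restrict_of_ae_restrict_of_subset hsub hle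
  have : ∫ _ in x..y, C⁻¹ ≤ ∫ z in x..y, deriv F z := by
    refine intervalIntegral.integral_mono_ae_restrict hxy.le intervalIntegrable_const hi ?_
    filter_upwards [hae, h1] with z hz hz1
    rw [geometricWeight_of_deriv_ne_zero (abs_pos.1 hz.2.1)] at hz1
    rw [hz.1]
    exact (inv_le_comm₀ hz.2.1 hC).1 hz1
  rw [heq, intervalIntegral.integral_const, smul_eq_mul] at this
  calc y - x = C * ((y - x) * C⁻¹) := by field_simp
    _ ≤ _ := by gcongr

/-- Where the geometric weight is at least `e`, the map is `e⁻¹`-Lipschitz on its branches. -/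
theorem mul_abs_sub_le (hd : HasGeometricPotential α β F) {e : ℝ} (he : 0 < e)
    (hge : ∀ᵐ z ∂leb α β, e ≤ geometricWeight F z) {Z : Set ℝ} (hord : Z.OrdConnected)
    (hsub : Z ⊆ Icc α β) (hc : ContinuousOn F Z) (hm : StrictMonoOn F Z ∨ StrictAntiOn F Z)
    {x y : ℝ} (hx : x ∈ Z) (hy : y ∈ Z) : e * |F x - F y| ≤ |x - y| := by
  wlog hxy : x < y generalizing x y
  · rcases (not_lt.1 hxy).eq_or_lt with rfl | h
    · simp
    · rw [abs_sub_comm, abs_sub_comm x]; exact this hy hx h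
  have hI := hord.out hx hy
  rw [abs_sub_comm, abs_sub_comm x, abs_of_pos (sub_pos.2 hxy)]
  rcases hm with hm | hm
  · rw [abs_of_pos (sub_pos.2 (hm hx hy hxy))]
    exact sub_le_of_strictMonoOn hd he hxy (hI.trans hsub) (hc.mono hI) (hm.mono hI) hge
  · have := sub_le_of_strictMonoOn hd.neg he hxy (hI.trans hsub) (hc.mono hI).neg
      (hm.mono hI).neg (by simpa only [geometricWeight_neg] using hge)
    rw [abs_of_neg (sub_neg.2 (hm hx hy hxy))]
    simpa [sub_eq_add_neg, add_comm] using this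

/-- Where the geometric weight is at most `C`, the map contracts distances on its branches at most
by the factor `C⁻¹`. -/
theorem abs_sub_le_mul (hd : HasGeometricPotential α β F) {e C : ℝ} (he : 0 < e)
    (hge : ∀ᵐ z ∂leb α β, e ≤ geometricWeight F z) (hC : 0 < C)
    (hle : ∀ᵐ z ∂leb α β, geometricWeight F z ≤ C) {Z : Set ℝ} (hord : Z.OrdConnected)
    (hsub : Z ⊆ Icc α β) (hc : ContinuousOn F Z) (hm : StrictMonoOn F Z ∨ StrictAntiOn F Z)
    {x y : ℝ} (hx : x ∈ Z) (hy : y ∈ Z) : |x - y| ≤ C * |F x - F y| := by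
  wlog hxy : x < y generalizing x y
  · rcases (not_lt.1 hxy).eq_or_lt with rfl | h
    · simp
    · rw [abs_sub_comm, abs_sub_comm (F x)]; exact this hy hx h
  have hI := hord.out hx hy
  rw [abs_sub_comm, abs_sub_comm (F x), abs_of_pos (sub_pos.2 hxy)]
  rcases hm with hm | hm
  · rw [abs_of_pos (sub_pos.2 (hm hx hy hxy))]
    exact le_sub_of_strictMonoOn hd he hxy (hI.trans hsub) (hc.mono hI) (hm.mono hI) hge hC hle
  · have := le_sub_of_strictMonoOn hd.neg he hxy (hI.trans hsub) (hc.mono hI).neg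
      (hm.mono hI).neg (by simpa only [geometricWeight_neg] using hge) hC
      (by simpa only [geometricWeight_neg] using hle)
    rw [abs_of_neg (sub_neg.2 (hm hx hy hxy))]
    simpa [sub_eq_add_neg, add_comm] using this

/-- The bounds on distances pass to the limit of difference quotients. Almost-everywhere bounds on
the weight thus become bounds at every point with a nonzero derivative. -/
theorem geometricWeight_mem_Icc {Z : Set ℝ} (hZ : IsOpen Z) {e C x : ℝ} (he : 0 < e) (hC : 0 < C)
    (hL : ∀ y ∈ Z, e * |F y - F x| ≤ |y - x|) (hU : ∀ y ∈ Z, |y - x| ≤ C * |F y - F x|)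
    (hx : x ∈ Z) (hdiff : DifferentiableAt ℝ F x) (hne : deriv F x ≠ 0) :
    geometricWeight F x ∈ Icc e C := by
  have hlim := (hasDerivAt_iff_tendsto_slope.1 hdiff.hasDerivAt).abs
  have hnhds : ∀ᶠ y in nhdsWithin x {x}ᶜ, y ∈ Z ∧ y ≠ x :=
    (Filter.Eventually.filter_mono nhdsWithin_le_nhds (hZ.eventually_mem hx)).and
      self_mem_nhdsWithin
  have hslope : ∀ y, |slope F x y| = |F y - F x| / |y - x| := fun y => by
    rw [slope_def_field, abs_div]
  rw [geometricWeight_of_deriv_ne_zero hne]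
  constructor
  · rw [le_inv_comm₀ he (abs_pos.2 hne)]
    refine le_of_tendsto hlim (hnhds.mono fun y hy => ?_)
    rw [hslope, div_le_iff₀ (abs_pos.2 (sub_ne_zero.2 hy.2)), ← div_eq_inv_mul, le_div_iff₀ he,
      mul_comm]
    exact hL y hy.1
  · rw [inv_le_comm₀ (abs_pos.2 hne) hC]
    refine ge_of_tendsto hlim (hnhds.mono fun y hy => ?_)
    rw [hslope, le_div_iff₀ (abs_pos.2 (sub_ne_zero.2 hy.2)), ← div_eq_inv_mul, div_le_iff₀ hC,
      mul_comm]
    exact hU y hy.1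

/-- The points of branches of `F` at which `F` has a nonzero derivative and a geometric weight in
`[e, C]`. -/
def regularPoints (α β : ℝ) (F : ℝ → ℝ) (e C : ℝ) : Set ℝ :=
  {x | x ∈ ⋃₀ monotonicityPartition α β F ∧ DifferentiableAt ℝ F x ∧ deriv F x ≠ 0 ∧
    geometricWeight F x ∈ Icc e C}

/-- Countability, rather than mere nullity, lets exceptional sets be transported along iterates:
both their preimages in I and their images stay countable. -/
theorem countable_diff_regularPoints (hp : IsPiecewiseMonotone α β F)
    (hd : HasGeometricPotential α β F) {e C : ℝ} (he : 0 < e)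
    (hge : ∀ᵐ z ∂leb α β, e ≤ geometricWeight F z) (hC : 0 < C)
    (hle : ∀ᵐ z ∂leb α β, geometricWeight F z ≤ C) :
    (Icc α β \ regularPoints α β F e C).Countable := by
  refine ((finite_diff_monotonicityPartition hp).countable.union hd).mono ?_
  rintro x ⟨hx, hxr⟩
  by_contra hcon
  obtain ⟨Z, hZ, hxZ⟩ : x ∈ ⋃₀ monotonicityPartition α β F := by
    by_contra h
    exact hcon (Or.inl ⟨hx, h⟩)
  obtain ⟨h1, h2⟩ : DifferentiableAt ℝ F x ∧ deriv F x ≠ 0 := by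
    by_contra h
    exact hcon (Or.inr ⟨hx, h⟩)
  obtain ⟨-, hop, hord, hsub, hc, hm⟩ := hZ.1
  exact hxr ⟨⟨Z, hZ, hxZ⟩, h1, h2, geometricWeight_mem_Icc hop he hC
    (fun y hy => mul_abs_sub_le hd he hge hord hsub hc hm hy hxZ)
    (fun y hy => abs_sub_le_mul hd he hge hC hle hord hsub hc hm hy hxZ) hxZ h1 h2⟩

end

section

/-! ### Branches of iterates -/

/-- `W` is a subinterval of `I` on which `F` is continuous and strictly monotone. -/
structure IsBranch (α β : ℝ) (F : ℝ → ℝ) (W : Set ℝ) : Prop where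
  ordConnected : W.OrdConnected
  subset : W ⊆ Icc α β
  continuousOn : ContinuousOn F W
  strictMonoOn_or : StrictMonoOn F W ∨ StrictAntiOn F W

variable {α β : ℝ}

theorem IsMonotonicityInterval.isBranch {F : ℝ → ℝ} {Z : Set ℝ}
    (h : IsMonotonicityInterval α β F Z) : IsBranch α β F Z :=
  ⟨h.2.2.1, h.2.2.2.1, h.2.2.2.2.1, h.2.2.2.2.2⟩

theorem IsBranch.injOn {F : ℝ → ℝ} {W : Set ℝ} (h : IsBranch α β F W) : InjOn F W :=
  h.strictMonoOn_or.elim StrictMonoOn.injOn StrictAntiOn.injOn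

theorem ordConnected_inter_preimage {G : ℝ → ℝ} {W Z : Set ℝ} (hW : W.OrdConnected)
    (hG : MonotoneOn G W ∨ AntitoneOn G W) (hZ : Z.OrdConnected) :
    (W ∩ G ⁻¹' Z).OrdConnected := by
  refine ⟨fun x hx y hy z hz => ?_⟩
  have hzW := hW.out hx.1 hy.1 hz
  refine ⟨hzW, ?_⟩
  rcases hG with hG | hG
  · exact hZ.out hx.2 hy.2 ⟨hG hx.1 hzW hz.1, hG hzW hy.1 hz.2⟩
  · exact hZ.out hy.2 hx.2 ⟨hG hzW hy.1 hz.2, hG hx.1 hzW hz.1⟩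

theorem IsBranch.comp {F G : ℝ → ℝ} {W Z : Set ℝ} (hZ : IsBranch α β F Z)
    (hW : IsBranch α β G W) : IsBranch α β (F ∘ G) (W ∩ G ⁻¹' Z) where
  ordConnected := ordConnected_inter_preimage hW.ordConnected
    (hW.strictMonoOn_or.imp StrictMonoOn.monotoneOn StrictAntiOn.antitoneOn) hZ.ordConnected
  subset := inter_subset_left.trans hW.subset
  continuousOn := hZ.continuousOn.comp (hW.continuousOn.mono inter_subset_left)
    fun _ hx => hx.2
  strictMonoOn_or := by
    have hmaps : MapsTo G (W ∩ G ⁻¹' Z) Z := fun _ hx => hx.2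
    have hs : W ∩ G ⁻¹' Z ⊆ W := inter_subset_left
    rcases hW.strictMonoOn_or with h | h <;> rcases hZ.strictMonoOn_or with h' | h'
    · exact Or.inl (h'.comp (h.mono hs) hmaps)
    · exact Or.inr (h'.comp_strictMonoOn (h.mono hs) hmaps)
    · exact Or.inr (h'.comp_strictAntiOn (h.mono hs) hmaps)
    · exact Or.inl (h'.comp (h.mono hs) hmaps)

namespace RandomClosedMap

variable {Ω : Type*} [MeasurableSpace Ω] {m : Measure Ω} (R : RandomClosedMap α β m)
  (σ : Ω → Ω) (ω : Ω)

theorem iter_mapsTo (n : ℕ) : MapsTo (R.iter σ n ω) (Icc α β) (Icc α β) := by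
  induction n with
  | zero => exact mapsTo_id _
  | succ n ih => exact (R.mapsTo _).comp ih

theorem iter_add (k n : ℕ) :
    R.iter σ (k + n) ω = R.iter σ n (σ^[k] ω) ∘ R.iter σ k ω := by
  induction n with
  | zero => rfl
  | succ n ih =>
    rw [← add_assoc, iter, iter, ih, ← Function.iterate_add_apply, Nat.add_comm n k]
    rfl

theorem mem_partition_zero {W : Set ℝ} (h : W ∈ R.partition σ 0 ω) : W = Icc α β := by
  obtain ⟨-, Z, -, rfl⟩ := h
  simp

theorem mem_partition_succ {n : ℕ} {W : Set ℝ} :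
    W ∈ R.partition σ (n + 1) ω ↔ W.Nonempty ∧ ∃ W' ∈ R.partition σ n ω,
      ∃ Z ∈ monotonicityPartition α β (R.T (σ^[n] ω)), W = W' ∩ R.iter σ n ω ⁻¹' Z := by
  constructor
  · rintro ⟨hne, Z, hZ, rfl⟩
    rw [biInter_lt_succ, ← inter_assoc] at hne ⊢
    exact ⟨hne, _, ⟨hne.mono inter_subset_left, Z, fun i hi => hZ i (by omega), rfl⟩, Z n,
      hZ n (by omega), rfl⟩
  · rintro ⟨hne, _, ⟨-, Z, hZ, rfl⟩, Zn, hZn, rfl⟩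
    refine ⟨hne, fun i => if i = n then Zn else Z i, fun i hi => ?_, ?_⟩
    · by_cases h : i = n
      · subst h; simpa using hZn
      · simpa [h] using hZ i (by omega)
    · rw [biInter_lt_succ, ← inter_assoc]
      simp only [if_true]
      congr 2
      refine iInter₂_congr fun i hi => ?_
      rw [if_neg hi.ne]

theorem isBranch_of_mem_partition {n : ℕ} {W : Set ℝ} (h : W ∈ R.partition σ n ω) :
    IsBranch α β (R.iter σ n ω) W := by
  induction n generalizing W with
  | zero =>
    rw [R.mem_partition_zero σ ω h]
    exact ⟨ordConnected_Icc, Subset.rfl, continuousOn_id, Or.inl (strictMono_id.strictMonoOn _)⟩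
  | succ n ih =>
    obtain ⟨-, W', hW', Z, hZ, rfl⟩ := (R.mem_partition_succ σ ω).1 h
    exact hZ.1.isBranch.comp (ih hW')

theorem finite_partition (n : ℕ) : (R.partition σ n ω).Finite := by
  induction n with
  | zero =>
    exact (finite_singleton (Icc α β)).subset fun W hW => R.mem_partition_zero σ ω hW
  | succ n ih =>
    refine (ih.image2 (fun W' Z => W' ∩ R.iter σ n ω ⁻¹' Z)
      (finite_monotonicityPartition (R.piecewiseMonotone (R.index (σ^[n] ω))))).subset ?_
    intro W hW
    obtain ⟨-, W', hW', Z, hZ, rfl⟩ := (R.mem_partition_succ σ ω).1 hW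
    exact mem_image2_of_mem hW' hZ

theorem eq_of_mem_partition {n : ℕ} {W₁ W₂ : Set ℝ} (h₁ : W₁ ∈ R.partition σ n ω)
    (h₂ : W₂ ∈ R.partition σ n ω) (hne : (W₁ ∩ W₂).Nonempty) : W₁ = W₂ := by
  induction n generalizing W₁ W₂ with
  | zero => rw [R.mem_partition_zero σ ω h₁, R.mem_partition_zero σ ω h₂]
  | succ n ih =>
    obtain ⟨-, W₁', hW₁', Z₁, hZ₁, rfl⟩ := (R.mem_partition_succ σ ω).1 h₁
    obtain ⟨-, W₂', hW₂', Z₂, hZ₂, rfl⟩ := (R.mem_partition_succ σ ω).1 h₂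
    obtain ⟨x, hx₁, hx₂⟩ := hne
    rw [ih hW₁' hW₂' ⟨x, hx₁.1, hx₂.1⟩,
      eq_of_mem_monotonicityPartition hZ₁ hZ₂ ⟨_, hx₁.2, hx₂.2⟩]

theorem finite_diff_partition (hαβ : α ≤ β) (n : ℕ) :
    (Icc α β \ ⋃₀ R.partition σ n ω).Finite := by
  induction n with
  | zero =>
    convert finite_empty
    refine sdiff_eq_empty.2 (subset_sUnion_of_mem ⟨nonempty_Icc.2 hαβ, fun _ => ∅, ?_, ?_⟩) <;> simp
  | succ n ih =>
    have hB := finite_diff_monotonicityPartition (R.piecewiseMonotone (R.index (σ^[n] ω)))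
    refine (ih.union ((R.finite_partition σ ω n).biUnion fun W hW =>
      Set.Finite.of_injOn (f := R.iter σ n ω) (s := W ∩ R.iter σ n ω ⁻¹' (Icc α β \
        ⋃₀ monotonicityPartition α β (R.map (R.index (σ^[n] ω))))) (fun x hx => hx.2)
        ((R.isBranch_of_mem_partition σ ω hW).injOn.mono inter_subset_left) hB)).subset ?_
    rintro x ⟨hx, hxn⟩
    by_cases h : x ∈ ⋃₀ R.partition σ n ω
    · obtain ⟨W, hW, hxW⟩ := h
      refine Or.inr (mem_iUnion₂.2 ⟨W, hW, hxW, R.iter_mapsTo σ ω n hx, ?_⟩)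
      rintro ⟨Z, hZ, hxZ⟩
      exact hxn ⟨W ∩ R.iter σ n ω ⁻¹' Z, (R.mem_partition_succ σ ω).2
        ⟨⟨x, hxW, hxZ⟩, W, hW, Z, hZ, rfl⟩, hxW, hxZ⟩
    · exact Or.inl ⟨hx, h⟩

theorem countable_preimage_iter (hαβ : α ≤ β) (n : ℕ) {B : Set ℝ} (hB : B.Countable) :
    (Icc α β ∩ R.iter σ n ω ⁻¹' B).Countable := by
  refine ((R.finite_diff_partition σ ω hαβ n).countable.union
    ((R.finite_partition σ ω n).countable.biUnion (t := fun W _ => W ∩ R.iter σ n ω ⁻¹' B)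
      fun W hW => ?_)).mono ?_
  · exact MapsTo.countable_of_injOn (f := R.iter σ n ω) (fun x hx => hx.2)
      ((R.isBranch_of_mem_partition σ ω hW).injOn.mono inter_subset_left) hB
  · rintro x ⟨hx, hxB⟩
    by_cases h : x ∈ ⋃₀ R.partition σ n ω
    · obtain ⟨W, hW, hxW⟩ := h
      exact Or.inr (mem_iUnion₂.2 ⟨W, hW, hxW, hxB⟩)
    · exact Or.inl ⟨hx, h⟩

/-- Full branches compose: an open Z ⊆ I lies in (α, β), hence in the image of any full branch of
the preceding iterate. -/
theorem nonempty_fullBranches (hαβ : α < β) (n : ℕ) :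
    (fullBranches α β (R.iter σ n ω) (R.partition σ n ω)).Nonempty := by
  induction n with
  | zero =>
    refine ⟨Icc α β, ⟨nonempty_Icc.2 hαβ.le, fun _ => ∅, ?_, ?_⟩, ?_⟩
    · simp
    · simp
    · rw [iter, image_id]; exact Ioo_subset_Icc_self
  | succ n ih =>
    obtain ⟨W, hW, hWf⟩ := ih
    obtain ⟨Z, hZ, hZf⟩ := R.full_branch (R.index (σ^[n] ω))
    have hZI : Z ⊆ Ioo α β := by
      rw [← interior_Icc]; exact interior_maximal hZ.1.2.2.2.1 hZ.1.2.1
    refine ⟨W ∩ R.iter σ n ω ⁻¹' Z, (R.mem_partition_succ σ ω).2 ⟨?_, W, hW, Z, hZ, rfl⟩, ?_⟩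
    · obtain ⟨z, hz⟩ := hZ.1.1
      obtain ⟨x, hx, rfl⟩ := hWf (hZI hz)
      exact ⟨x, hx, hz⟩
    · intro y hy
      obtain ⟨z, hz, rfl⟩ := hZf hy
      obtain ⟨x, hx, rfl⟩ := hWf (hZI hz)
      exact ⟨x, ⟨hx, hz⟩, rfl⟩

/-- The weights `1 / |T_{σ^i ω}'|` are almost everywhere in `[e i, C i]`, with `e i` positive. -/
structure IsBounded (e C : ℕ → ℝ) : Prop where
  pos : ∀ i, 0 < e i
  pos' : ∀ i, 0 < C i
  ge : ∀ i, ∀ᵐ x ∂leb α β, e i ≤ geometricWeight (R.T (σ^[i] ω)) x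
  le : ∀ i, ∀ᵐ x ∂leb α β, geometricWeight (R.T (σ^[i] ω)) x ≤ C i

variable {R σ ω} {e C : ℕ → ℝ}

theorem IsBounded.abs_sub_le (hb : R.IsBounded σ ω e C)
    (hd : ∀ j, HasGeometricPotential α β (R.map j)) {n : ℕ} {W : Set ℝ}
    (hW : W ∈ R.partition σ n ω) {x y : ℝ} (hx : x ∈ W) (hy : y ∈ W) :
    |x - y| ≤ (∏ i ∈ Finset.range n, C i) * |R.iter σ n ω x - R.iter σ n ω y| := by
  induction n generalizing W with
  | zero => simp [iter]
  | succ n ih =>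
    obtain ⟨-, W', hW', Z, hZ, rfl⟩ := (R.mem_partition_succ σ ω).1 hW
    refine (ih hW' hx.1 hy.1).trans ?_
    rw [Finset.prod_range_succ, mul_assoc]
    have h := hZ.1.isBranch
    exact mul_le_mul_of_nonneg_left (abs_sub_le_mul (hd _) (hb.pos n) (hb.ge n) (hb.pos' n)
      (hb.le n) h.ordConnected h.subset h.continuousOn h.strictMonoOn_or hx.2 hy.2)
      (Finset.prod_nonneg fun i _ => (hb.pos' i).le)

/-- The points whose orbit up to time `n` consists of regular points. -/
def regularOrbit (R : RandomClosedMap α β m) (σ : Ω → Ω) (ω : Ω) (e C : ℕ → ℝ) (n : ℕ) : Set ℝ :=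
  {x | ∀ i < n, R.iter σ i ω x ∈ regularPoints α β (R.T (σ^[i] ω)) (e i) (C i)}

theorem IsBounded.countable_diff_regularOrbit (hαβ : α ≤ β) (hb : R.IsBounded σ ω e C)
    (hd : ∀ j, HasGeometricPotential α β (R.map j)) (n : ℕ) :
    (Icc α β \ R.regularOrbit σ ω e C n).Countable := by
  refine ((Set.to_countable (Iio n)).biUnion fun i _ => R.countable_preimage_iter σ ω hαβ i
    (countable_diff_regularPoints (R.piecewiseMonotone _) (hd _) (hb.pos i) (hb.ge i)
      (hb.pos' i) (hb.le i))).mono ?_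
  rintro x ⟨hx, hxr⟩
  simp only [regularOrbit, mem_ofPred_eq, not_forall] at hxr
  obtain ⟨i, hi, hxi⟩ := hxr
  exact mem_iUnion₂.2 ⟨i, hi, hx, R.iter_mapsTo σ ω i hx, hxi⟩

/-- By the chain rule the n-step weight is the geometric weight of the iterate, so the one-map
distance estimates apply to iterates. -/
theorem hasDerivAt_iter {n : ℕ} {x : ℝ} (hx : x ∈ R.regularOrbit σ ω e C n) :
    ∃ d, d ≠ 0 ∧ HasDerivAt (R.iter σ n ω) d x ∧
      R.weightIter σ (fun j => geometricWeight (R.map j)) n ω x = |d|⁻¹ := by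
  induction n with
  | zero => exact ⟨1, one_ne_zero, hasDerivAt_id x, by simp [weightIter]⟩
  | succ n ih =>
    obtain ⟨d, hd, hder, hw⟩ := ih fun i hi => hx i (by omega)
    obtain ⟨-, h1, h2, -⟩ := hx n (by omega)
    refine ⟨_, mul_ne_zero h2 hd, h1.hasDerivAt.comp x hder, ?_⟩
    rw [weightIter] at hw ⊢
    rw [Finset.prod_range_succ, hw, abs_mul, mul_inv, mul_comm,
      ← geometricWeight_of_deriv_ne_zero h2]
    rfl

theorem weightIter_mem_Icc (hpos : ∀ i, 0 < e i) {n : ℕ} {x : ℝ}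
    (hx : x ∈ R.regularOrbit σ ω e C n) :
    R.weightIter σ (fun j => geometricWeight (R.map j)) n ω x ∈
      Icc (∏ i ∈ Finset.range n, e i) (∏ i ∈ Finset.range n, C i) :=
  ⟨Finset.prod_le_prod (fun i _ => (hpos i).le) fun i hi => (hx i (Finset.mem_range.1 hi)).2.2.2.1,
    Finset.prod_le_prod (fun _ _ => (geometricWeight_pos _ _).le)
      fun i hi => (hx i (Finset.mem_range.1 hi)).2.2.2.2⟩

theorem IsBounded.hasGeometricPotential_iter (hαβ : α ≤ β) (hb : R.IsBounded σ ω e C)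
    (hd : ∀ j, HasGeometricPotential α β (R.map j)) (n : ℕ) :
    HasGeometricPotential α β (R.iter σ n ω) := by
  refine (hb.countable_diff_regularOrbit hαβ hd n).mono ?_
  rintro x ⟨hx, hxn⟩
  refine ⟨hx, fun hr => hxn ?_⟩
  obtain ⟨d, hd0, hder, -⟩ := hasDerivAt_iter hr
  exact ⟨hder.differentiableAt, by rwa [hder.deriv]⟩

theorem ae_leb_of_countable {p : ℝ → Prop} {s : Set ℝ} (hs : (Icc α β \ s).Countable)
    (h : ∀ x ∈ s, p x) : ∀ᵐ x ∂leb α β, p x := by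
  filter_upwards [ae_restrict_of_ae (measure_eq_zero_iff_ae_notMem.1 (hs.measure_zero volume)),
    ae_restrict_mem measurableSet_Icc] with x hx hxI
  by_contra hp
  exact hx ⟨hxI, fun hxs => hp (h x hxs)⟩

end RandomClosedMap

end

section

/-! ### Essential bounds -/

variable {α β : ℝ}

theorem leb_ne_zero (hαβ : α < β) : leb α β ≠ 0 := by
  rw [leb, Ne, Measure.restrict_eq_zero, Real.volume_Icc, ENNReal.ofReal_eq_zero, not_le]
  linarith

theorem le_einf (hαβ : α < β) {h : ℝ → ℝ} {c : ℝ} (hc : ∀ᵐ x ∂leb α β, c ≤ h x) :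
    c ≤ einf α β h := by
  have : (ae (leb α β)).NeBot := ae_neBot.2 (leb_ne_zero hαβ)
  -- The real-valued `essInf` is meaningful only if the almost-everywhere lower bounds are bounded
  -- above. Otherwise h would exceed every integer at a single point, as the measure is nonzero.
  refine le_essInf_of_ae_le c hc ?_
  change Filter.IsCobounded _ _
  by_contra hcon
  simp only [Filter.IsCobounded, not_exists, not_forall] at hcon
  have key : ∀ n : ℕ, ∀ᵐ x ∂leb α β, (n : ℝ) ≤ h x := by
    intro n
    obtain ⟨a, ha, han⟩ := hcon n
    filter_upwards [ha] with x hx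
    exact (not_le.1 han).le.trans hx
  obtain ⟨x, hx⟩ := (ae_all_iff.2 key).exists
  obtain ⟨n, hn⟩ := exists_nat_gt (h x)
  exact absurd (hx n) (not_le.2 hn)

theorem ae_einf_le {h : ℝ → ℝ} {c : ℝ} (hc : ∀ᵐ x ∂leb α β, c ≤ h x) :
    ∀ᵐ x ∂leb α β, einf α β h ≤ h x :=
  ae_essInf_le ⟨c, hc⟩

theorem ae_le_supNorm {g : ℝ → ℝ} (hαβ : α ≤ β) (hg : essVar α β g ≠ ∞) :
    ∀ᵐ x ∂leb α β, g x ≤ supNorm α β g := by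
  -- Finite variation yields essential boundedness, without which `essSup` would be a default value.
  have hbdd : ∃ c, ∀ᵐ x ∂leb α β, |g x| ≤ c := by
    simp only [essVar, ne_eq, iInf_eq_top, not_forall] at hg
    obtain ⟨h, hh, hv⟩ := hg
    refine ⟨|h α| + (eVariationOn h (Icc α β)).toReal, ?_⟩
    filter_upwards [hh, ae_restrict_mem measurableSet_Icc] with x hx hxI
    have hdist := eVariationOn.edist_le h hxI (left_mem_Icc.2 hαβ)
    rw [edist_dist, ENNReal.ofReal_le_iff_le_toReal hv, Real.dist_eq] at hdist
    rw [← hx]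
    calc |h x| = |h α + (h x - h α)| := by ring_nf
      _ ≤ |h α| + |h x - h α| := abs_add_le _ _
      _ ≤ _ := by gcongr
  have := ae_le_essSup (f := fun x => |g x|) (μ := leb α β) hbdd
  filter_upwards [this] with x hx using (le_abs_self _).trans hx

/-! ### Lengths of intervals in images -/

/-- The supremum of the lengths of the open intervals contained in `S`. -/
def intervalLength (S : Set ℝ) : ℝ := sSup {d | ∃ a b, a ≤ b ∧ d = b - a ∧ Ioo a b ⊆ S}

theorem mem_upperBounds_intervalLength {S : Set ℝ} (hαβ : α ≤ β) (hS : S ⊆ Icc α β) :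
    β - α ∈ upperBounds {d | ∃ a b, a ≤ b ∧ d = b - a ∧ Ioo a b ⊆ S} := by
  rintro d ⟨a, b, hab, rfl, h⟩
  have := measure_mono (μ := volume) (h.trans hS)
  rwa [Real.volume_Ioo, Real.volume_Icc, ENNReal.ofReal_le_ofReal_iff (by linarith)] at this

theorem sub_le_intervalLength {S : Set ℝ} (hαβ : α ≤ β) (hS : S ⊆ Icc α β) {a b : ℝ} (hab : a ≤ b)
    (h : Ioo a b ⊆ S) : b - a ≤ intervalLength S :=
  le_csSup ⟨_, mem_upperBounds_intervalLength hαβ hS⟩ ⟨a, b, hab, rfl, h⟩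

theorem intervalLength_le {S : Set ℝ} {c : ℝ}
    (h : ∀ a b, a ≤ b → Ioo a b ⊆ S → b - a ≤ c) : intervalLength S ≤ c := by
  -- Degenerate intervals are allowed, so the supremum is over a nonempty set.
  refine csSup_le ⟨0, 0, 0, le_rfl, by simp, by simp⟩ ?_
  rintro d ⟨a, b, hab, rfl, hs⟩
  exact h a b hab hs

theorem intervalLength_nonneg {S : Set ℝ} (hαβ : α ≤ β) (hS : S ⊆ Icc α β) :
    0 ≤ intervalLength S := by
  simpa using sub_le_intervalLength hαβ hS (le_refl (0 : ℝ)) (by simp)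

theorem intervalLength_mono {S S' : Set ℝ} (hαβ : α ≤ β) (hS : S' ⊆ Icc α β) (h : S ⊆ S') :
    intervalLength S ≤ intervalLength S' :=
  intervalLength_le fun _ _ hab hs => sub_le_intervalLength hαβ hS hab (hs.trans h)

namespace RandomClosedMap

variable {Ω : Type*} [MeasurableSpace Ω] {m : Measure Ω} {R : RandomClosedMap α β m}
  {σ : Ω → Ω} {ω : Ω} {e C : ℕ → ℝ}

/-- By the intermediate value theorem the image of J contains the whole interval between the images
of two points of W ∩ J. The distance estimate then bounds the diameter of W ∩ J. -/
theorem IsBounded.volume_inter_le (hαβ : α ≤ β) (hb : R.IsBounded σ ω e C)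
    (hd : ∀ j, HasGeometricPotential α β (R.map j)) {n : ℕ} {W J : Set ℝ}
    (hW : W ∈ R.partition σ n ω) (hJ : J.OrdConnected) (hJI : J ⊆ Icc α β) :
    volume (W ∩ J) ≤ ENNReal.ofReal
      ((∏ i ∈ Finset.range n, C i) * intervalLength (R.iter σ n ω '' J)) := by
  have hbr := R.isBranch_of_mem_partition σ ω hW
  refine (Real.volume_le_diam _).trans (Metric.ediam_le ?_)
  rintro x ⟨hxW, hxJ⟩ y ⟨hyW, hyJ⟩
  rw [edist_dist, Real.dist_eq]
  refine ENNReal.ofReal_le_ofReal ((hb.abs_sub_le hd hW hxW hyW).trans ?_)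
  refine mul_le_mul_of_nonneg_left ?_ (Finset.prod_nonneg fun i _ => (hb.pos' i).le)
  have hiv := intermediate_value_uIcc
    (hbr.continuousOn.mono (hbr.ordConnected.uIcc_subset hxW hyW))
  have himg : R.iter σ n ω '' J ⊆ Icc α β := by
    rintro _ ⟨z, hz, rfl⟩
    exact R.iter_mapsTo σ ω n (hJI hz)
  rw [abs_sub_comm, ← max_sub_min_eq_abs]
  exact sub_le_intervalLength hαβ himg min_le_max
    (Ioo_subset_Icc_self.trans (hiv.trans (image_mono (hJ.uIcc_subset hxJ hyJ))))

/-- The elements of the `n`-th monotonicity partition that meet `J`. -/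
def meeting (R : RandomClosedMap α β m) (σ : Ω → Ω) (n : ℕ) (ω : Ω) (J : Set ℝ) : Set (Set ℝ) :=
  {W ∈ R.partition σ n ω | (W ∩ J).Nonempty}

theorem IsBounded.sub_le_ncard_mul (hαβ : α ≤ β) (hb : R.IsBounded σ ω e C)
    (hd : ∀ j, HasGeometricPotential α β (R.map j)) (n : ℕ) {a b : ℝ} (hJI : Ioo a b ⊆ Icc α β) :
    b - a ≤ (R.meeting σ n ω (Ioo a b)).ncard * ((∏ i ∈ Finset.range n, C i) *
      intervalLength (R.iter σ n ω '' Ioo a b)) := by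
  have hfin : (R.meeting σ n ω (Ioo a b)).Finite :=
    (R.finite_partition σ ω n).subset (sep_subset _ _)
  have himg : R.iter σ n ω '' Ioo a b ⊆ Icc α β := by
    rintro _ ⟨z, hz, rfl⟩
    exact R.iter_mapsTo σ ω n (hJI hz)
  have hnn : 0 ≤ (∏ i ∈ Finset.range n, C i) * intervalLength (R.iter σ n ω '' Ioo a b) :=
    mul_nonneg (Finset.prod_nonneg fun i _ => (hb.pos' i).le) (intervalLength_nonneg hαβ himg)
  have hcover : Ioo a b ⊆ (Icc α β \ ⋃₀ R.partition σ n ω) ∪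
      ⋃ W ∈ hfin.toFinset, W ∩ Ioo a b := by
    intro x hx
    by_cases h : x ∈ ⋃₀ R.partition σ n ω
    · obtain ⟨W, hW, hxW⟩ := h
      exact Or.inr (mem_iUnion₂.2 ⟨W, hfin.mem_toFinset.2 ⟨hW, x, hxW, hx⟩, hxW, hx⟩)
    · exact Or.inl ⟨hJI hx, h⟩
  have : volume (Ioo a b) ≤ (R.meeting σ n ω (Ioo a b)).ncard *
      ENNReal.ofReal ((∏ i ∈ Finset.range n, C i) *
        intervalLength (R.iter σ n ω '' Ioo a b)) := by
    refine (measure_mono hcover).trans ((measure_union_le _ _).trans ?_)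
    rw [(R.finite_diff_partition σ ω hαβ n).measure_zero, zero_add]
    refine (measure_biUnion_finset_le _ _).trans ((Finset.sum_le_card_nsmul _ _ _ fun W hW =>
      hb.volume_inter_le hαβ hd (hfin.mem_toFinset.1 hW).1 ordConnected_Ioo hJI).trans ?_)
    rw [ncard_eq_toFinset_card _ hfin, nsmul_eq_mul]
  rw [Real.volume_Ioo, ← ENNReal.ofReal_natCast, ← ENNReal.ofReal_mul (Nat.cast_nonneg _)] at this
  exact (ENNReal.ofReal_le_ofReal_iff (mul_nonneg (Nat.cast_nonneg _) hnn)).1 this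

theorem ncard_le_maxContiguous {F : ℝ → ℝ} {P : Set (Set ℝ)} (hP : P.Finite) {a b : ℝ}
    (h : ∀ W ∈ fullBranches α β F P, ¬ W ⊆ Ioo a b) :
    {W ∈ P | W ⊆ Ioo a b}.ncard ≤ maxContiguous α β F P := by
  have hfin : {W ∈ P | W ⊆ Ioo a b}.Finite := hP.subset (sep_subset _ _)
  -- A supremum in ℕ needs a bound; the cardinality of the partition serves.
  refine le_csSup ⟨P.ncard, ?_⟩ ⟨hfin.toFinset, ⟨?_, ?_⟩, (ncard_eq_toFinset_card _ hfin).symm⟩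
  · rintro k ⟨D, hD, rfl⟩
    rw [← ncard_coe_finset]
    exact ncard_le_ncard (fun W hW => (hD.1 W hW).1) hP
  · intro W hW
    have hW := hfin.mem_toFinset.1 hW
    exact ⟨hW.1, fun hfull => h W ⟨hW.1, hfull⟩ hW.2⟩
  · intro W hW hsub
    refine h W hW (hsub.trans (convexHull_min ?_ (convex_Ioo a b)))
    exact iUnion₂_subset fun Z hZ => (hfin.mem_toFinset.1 hZ).2

/-- An element that meets (a, b) without lying inside contains a or b, and disjointness allows one
element for each endpoint. -/
theorem ncard_meeting_le {n : ℕ} {a b : ℝ}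
    (h : ∀ W ∈ fullBranches α β (R.iter σ n ω) (R.partition σ n ω), ¬ W ⊆ Ioo a b) :
    (R.meeting σ n ω (Ioo a b)).ncard ≤
      maxContiguous α β (R.iter σ n ω) (R.partition σ n ω) + 2 := by
  have hP := R.finite_partition σ ω n
  have hone : ∀ c : ℝ, {W ∈ R.partition σ n ω | c ∈ W}.ncard ≤ 1 := fun c =>
    (ncard_le_one (hP.subset (sep_subset _ _))).2 fun W hW W' hW' =>
      R.eq_of_mem_partition σ ω hW.1 hW'.1 ⟨c, hW.2, hW'.2⟩
  have hsub : R.meeting σ n ω (Ioo a b) ⊆ {W ∈ R.partition σ n ω | W ⊆ Ioo a b} ∪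
      ({W ∈ R.partition σ n ω | a ∈ W} ∪ {W ∈ R.partition σ n ω | b ∈ W}) := by
    rintro W ⟨hW, x, hxW, hx⟩
    by_cases hin : W ⊆ Ioo a b
    · exact Or.inl ⟨hW, hin⟩
    right
    have hord := (R.isBranch_of_mem_partition σ ω hW).ordConnected
    obtain ⟨y, hyW, hy⟩ := not_subset.1 hin
    by_cases hya : y ≤ a
    · exact Or.inl ⟨hW, hord.out hyW hxW ⟨hya, hx.1.le⟩⟩
    · have hyb : b ≤ y := by
        by_contra hyb
        exact hy ⟨not_le.1 hya, not_le.1 hyb⟩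
      exact Or.inr ⟨hW, hord.out hxW hyW ⟨hx.2.le, hyb⟩⟩
  have hfin : ({W ∈ R.partition σ n ω | W ⊆ Ioo a b} ∪
      ({W ∈ R.partition σ n ω | a ∈ W} ∪ {W ∈ R.partition σ n ω | b ∈ W})).Finite :=
    hP.subset (union_subset (sep_subset _ _) (union_subset (sep_subset _ _) (sep_subset _ _)))
  have h1 := ncard_le_ncard hsub hfin
  have h2 := ncard_union_le {W ∈ R.partition σ n ω | W ⊆ Ioo a b}
      ({W ∈ R.partition σ n ω | a ∈ W} ∪ {W ∈ R.partition σ n ω | b ∈ W})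
  have h3 := ncard_union_le {W ∈ R.partition σ n ω | a ∈ W} {W ∈ R.partition σ n ω | b ∈ W}
  have h4 := ncard_le_maxContiguous hP h
  have h5 := hone a
  have h6 := hone b
  omega

/-- The full branches of the `n`-th iterate have total length at most that of `I`. -/
theorem IsBounded.ncard_fullBranches_mul_einf_le (hαβ : α < β) (hb : R.IsBounded σ ω e C)
    (hd : ∀ j, HasGeometricPotential α β (R.map j)) (n : ℕ) :
    0 < einf α β (R.weightIter σ (fun j => geometricWeight (R.map j)) n ω) ∧
    (fullBranches α β (R.iter σ n ω) (R.partition σ n ω)).ncard *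
      einf α β (R.weightIter σ (fun j => geometricWeight (R.map j)) n ω) ≤ 1 := by
  set w := R.weightIter σ (fun j => geometricWeight (R.map j)) n ω
  have hcount := hb.countable_diff_regularOrbit hαβ.le hd n
  have hge : ∀ᵐ x ∂leb α β, ∏ i ∈ Finset.range n, e i ≤ w x :=
    ae_leb_of_countable hcount fun x hx => (weightIter_mem_Icc hb.pos hx).1
  have hpos : 0 < einf α β w :=
    (Finset.prod_pos fun i _ => hb.pos i).trans_le (le_einf hαβ hge)
  refine ⟨hpos, ?_⟩
  have hwg : ∀ᵐ x ∂leb α β, einf α β w ≤ geometricWeight (R.iter σ n ω) x := by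
    filter_upwards [ae_einf_le hge, ae_leb_of_countable (p := fun x =>
      geometricWeight (R.iter σ n ω) x = w x) hcount fun x hx => by
        obtain ⟨d, hd0, hder, hw⟩ := hasDerivAt_iter hx
        rw [geometricWeight_of_deriv_ne_zero (by rwa [hder.deriv]), hder.deriv, ← hw]]
      with x h1 h2
    rw [h2]; exact h1
  set E := einf α β w
  have hfin : (fullBranches α β (R.iter σ n ω) (R.partition σ n ω)).Finite :=
    (R.finite_partition σ ω n).subset (sep_subset _ _)
  have hvol : ∀ W ∈ hfin.toFinset, ENNReal.ofReal (E * (β - α)) ≤ volume W := by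
    intro W hW
    have hW := hfin.mem_toFinset.1 hW
    have hbr := R.isBranch_of_mem_partition σ ω hW.1
    have hlip : LipschitzOnWith (Real.toNNReal E⁻¹) (R.iter σ n ω) W := by
      refine LipschitzOnWith.of_dist_le_mul fun x hx y hy => ?_
      have := mul_abs_sub_le (hb.hasGeometricPotential_iter hαβ.le hd n) hpos hwg
        hbr.ordConnected hbr.subset hbr.continuousOn hbr.strictMonoOn_or hx hy
      rw [Real.coe_toNNReal _ (inv_nonneg.2 hpos.le), Real.dist_eq, Real.dist_eq,
        ← div_eq_inv_mul, le_div_iff₀ hpos, mul_comm]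
      exact this
    -- One-dimensional Hausdorff measure is Lebesgue measure, so an E⁻¹-Lipschitz branch covering
    -- (α, β) has length at least E(β - α).
    have h1 := hlip.hausdorffMeasure_image_le zero_le_one
    rw [hausdorffMeasure_real, ENNReal.rpow_one] at h1
    have h2 := (measure_mono hW.2).trans h1
    rw [Real.volume_Ioo] at h2
    rw [ENNReal.ofReal_mul hpos.le]
    refine (mul_le_mul_right h2 _).trans (le_of_eq ?_)
    change ENNReal.ofReal E * (ENNReal.ofReal E⁻¹ * _) = _
    rw [← mul_assoc, ← ENNReal.ofReal_mul hpos.le, mul_inv_cancel₀ hpos.ne',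
      ENNReal.ofReal_one, one_mul]
  have hsum : ∑ W ∈ hfin.toFinset, volume W ≤ volume (Icc α β) := by
    rw [← measure_biUnion_finset (f := fun W : Set ℝ => W)]
    · exact measure_mono (iUnion₂_subset fun W hW =>
        (R.isBranch_of_mem_partition σ ω (hfin.mem_toFinset.1 hW).1).subset)
    · intro W hW W' hW' hne
      rw [Function.onFun, disjoint_iff_inter_eq_empty]
      by_contra h
      exact hne (R.eq_of_mem_partition σ ω (hfin.mem_toFinset.1 hW).1
        (hfin.mem_toFinset.1 hW').1 (nonempty_iff_ne_empty.2 h))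
    · exact fun W hW => (R.isBranch_of_mem_partition σ ω
        (hfin.mem_toFinset.1 hW).1).ordConnected.measurableSet
  have hfinal := (Finset.card_nsmul_le_sum _ _ _ hvol).trans hsum
  rw [← ncard_eq_toFinset_card _ hfin, nsmul_eq_mul, Real.volume_Icc, ← ENNReal.ofReal_natCast,
    ← ENNReal.ofReal_mul (Nat.cast_nonneg _), ENNReal.ofReal_le_ofReal_iff (by linarith),
    ← mul_assoc] at hfinal
  have : 0 < β - α := by linarith
  exact le_of_mul_le_mul_right (by linarith) this

theorem IsBounded.le_contractionCoeff (hαβ : α < β)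
    (hb : R.IsBounded σ ω e fun i => supNorm α β (geometricWeight (R.T (σ^[i] ω))))
    (hd : ∀ j, HasGeometricPotential α β (R.map j)) (n : ℕ) :
    ((maxContiguous α β (R.iter σ n ω) (R.partition σ n ω) + 2 : ℕ) : ℝ) *
      ∏ i ∈ Finset.range n, supNorm α β (geometricWeight (R.T (σ^[i] ω))) ≤
    R.contractionCoeff σ (fun j => geometricWeight (R.map j)) n ω := by
  obtain ⟨hE, hbE⟩ := hb.ncard_fullBranches_mul_einf_le hαβ hd n
  have hbpos : 0 < ((fullBranches α β (R.iter σ n ω) (R.partition σ n ω)).ncard : ℝ) := by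
    exact_mod_cast (ncard_pos ((R.finite_partition σ ω n).subset (sep_subset _ _))).2
      (R.nonempty_fullBranches σ ω hαβ n)
  rw [contractionCoeff]
  set ξ := maxContiguous α β (R.iter σ n ω) (R.partition σ n ω)
  set E := einf α β (R.weightIter σ (fun j => geometricWeight (R.map j)) n ω)
  set B := ((fullBranches α β (R.iter σ n ω) (R.partition σ n ω)).ncard : ℝ)
  have hV : 0 ≤ ∑ i ∈ Finset.range n,
      R.varRatio (fun j => geometricWeight (R.map j)) (σ^[i] ω) :=
    Finset.sum_nonneg fun i _ => div_nonneg ENNReal.toReal_nonneg (hb.pos' i).le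
  have hP : 0 ≤ ∏ i ∈ Finset.range n, supNorm α β (geometricWeight (R.T (σ^[i] ω))) :=
    Finset.prod_nonneg fun i _ => (hb.pos' i).le
  change _ ≤ _ * _ * ((∏ i ∈ Finset.range n, supNorm α β (geometricWeight (R.T (σ^[i] ω)))) / E) *
    (1 / B)
  set S := ∏ i ∈ Finset.range n, supNorm α β (geometricWeight (R.T (σ^[i] ω)))
  set V := ∑ i ∈ Finset.range n, R.varRatio (fun j => geometricWeight (R.map j)) (σ^[i] ω)
  have hξ : (0 : ℝ) ≤ ξ := Nat.cast_nonneg _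
  have h1 : S ≤ S / E * (1 / B) := by
    rw [div_mul_div_comm, mul_one, mul_comm E]
    exact le_div_self hP (mul_pos hbpos hE) hbE
  have h2 : ((ξ + 2 : ℕ) : ℝ) ≤ (3 + 3 * V) * (1 + 2 * ξ) := by
    push_cast
    nlinarith [mul_nonneg hV hξ]
  rw [mul_assoc _ (S / E)]
  exact mul_le_mul h2 h1 hP ((Nat.cast_nonneg _).trans h2)

/-- An interval without a full branch of the `n`-th iterate is expanded by that iterate, up to the
contraction coefficient. -/
theorem IsBounded.sub_le_contractionCoeff_mul (hαβ : α < β)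
    (hb : R.IsBounded σ ω e fun i => supNorm α β (geometricWeight (R.T (σ^[i] ω))))
    (hd : ∀ j, HasGeometricPotential α β (R.map j)) (n : ℕ) {a b : ℝ} (hJI : Ioo a b ⊆ Icc α β)
    (h : ∀ W ∈ fullBranches α β (R.iter σ n ω) (R.partition σ n ω), ¬ W ⊆ Ioo a b) :
    b - a ≤ R.contractionCoeff σ (fun j => geometricWeight (R.map j)) n ω *
      intervalLength (R.iter σ n ω '' Ioo a b) := by
  have himg : R.iter σ n ω '' Ioo a b ⊆ Icc α β := by
    rintro _ ⟨z, hz, rfl⟩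
    exact R.iter_mapsTo σ ω n (hJI hz)
  have hl := intervalLength_nonneg hαβ.le himg
  refine (hb.sub_le_ncard_mul hαβ.le hd n hJI).trans ?_
  rw [← mul_assoc]
  refine mul_le_mul_of_nonneg_right (le_trans ?_ (hb.le_contractionCoeff hαβ hd n)) hl
  exact mul_le_mul_of_nonneg_right (by exact_mod_cast ncard_meeting_le h)
    (Finset.prod_nonneg fun i _ => (hb.pos' i).le)

end RandomClosedMap

end

section

variable {α β : ℝ}

/-! ### Lower bounds for the transfer operator -/

theorem transfer_nonneg {F g f : ℝ → ℝ} (hg : ∀ x, 0 ≤ g x) (hf : ∀ x, 0 ≤ f x) (y : ℝ) :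
    0 ≤ transfer α β F g f y :=
  finsum_nonneg fun _ => finsum_nonneg fun _ =>
    indicator_nonneg (fun _ _ => mul_nonneg (hf _) (hg _)) _

/-- All terms are nonnegative, so the sum dominates the term of the branch through x. -/
theorem mul_le_transfer {F g f : ℝ → ℝ} (hF : IsPiecewiseMonotone α β F) (hg : ∀ x, 0 ≤ g x)
    (hf : ∀ x, 0 ≤ f x) {x : ℝ} (hx : x ∈ ⋃₀ monotonicityPartition α β F) :
    f x * g x ≤ transfer α β F g f (F x) := by
  obtain ⟨Z, hZ, hxZ⟩ := hx
  have hfin := finite_monotonicityPartition hF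
  rw [transfer, finsum_mem_eq_finite_toFinset_sum _ hfin]
  refine le_trans (le_of_eq ?_) (Finset.single_le_sum (fun Z _ =>
    indicator_nonneg (fun _ _ => mul_nonneg (hf _) (hg _)) _) (hfin.mem_toFinset.2 hZ))
  rw [indicator_of_mem (mem_image_of_mem F hxZ), hZ.1.isBranch.injOn.leftInvOn_invFunOn hxZ]

namespace RandomClosedMap

variable {Ω : Type*} [MeasurableSpace Ω] {m : Measure Ω} {R : RandomClosedMap α β m}
  {σ : Ω → Ω} {ω : Ω} {e C : ℕ → ℝ}

theorem transferIter_nonneg {f : ℝ → ℝ} (hf : ∀ x, 0 ≤ f x) (n : ℕ) (x : ℝ) :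
    0 ≤ R.transferIter σ (fun j => geometricWeight (R.map j)) n ω f x := by
  induction n generalizing x with
  | zero => exact hf x
  | succ n ih => exact transfer_nonneg (fun _ => (geometricWeight_pos _ _).le) ih x

theorem IsBounded.le_transferIter (hb : R.IsBounded σ ω e C)
    (hd : ∀ j, HasGeometricPotential α β (R.map j)) {f : ℝ → ℝ} (hf : ∀ x, 0 ≤ f x) {J : Set ℝ}
    (hJ : J ⊆ Icc α β) {δ : ℝ} (hfJ : ∀ x ∈ J, δ ≤ f x) (n : ℕ) :
    ∃ E : Set ℝ, E.Countable ∧ ∀ y ∈ R.iter σ n ω '' J, y ∉ E → δ * ∏ i ∈ Finset.range n, e i ≤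
      R.transferIter σ (fun j => geometricWeight (R.map j)) n ω f y := by
  induction n with
  | zero =>
    refine ⟨∅, countable_empty, ?_⟩
    rintro _ ⟨x, hx, rfl⟩ -
    simpa [transferIter, iter] using hfJ x hx
  | succ n ih =>
    obtain ⟨E, hE, h⟩ := ih
    have hc := countable_diff_regularPoints (R.piecewiseMonotone (R.index (σ^[n] ω))) (hd _)
      (hb.pos n) (hb.ge n) (hb.pos' n) (hb.le n)
    -- The images of the earlier exceptional values and of the irregular points are discarded; every
    -- remaining value is reached through a regular point where the induction hypothesis holds.
    refine ⟨R.T (σ^[n] ω) '' (E ∪ (Icc α β \ regularPoints α β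
      (R.map (R.index (σ^[n] ω))) (e n) (C n))), (hE.union hc).image _, ?_⟩
    rintro _ ⟨x, hx, rfl⟩ hxE
    have hzE : R.iter σ n ω x ∉ E := fun hz => hxE ⟨_, Or.inl hz, rfl⟩
    have hreg : R.iter σ n ω x ∈ regularPoints α β (R.map (R.index (σ^[n] ω))) (e n) (C n) := by
      by_contra hz
      exact hxE ⟨_, Or.inr ⟨R.iter_mapsTo σ ω n (hJ hx), hz⟩, rfl⟩
    have hz := h _ ⟨x, hx, rfl⟩ hzE
    rw [Finset.prod_range_succ, ← mul_assoc]
    refine le_trans ?_ (mul_le_transfer (R.piecewiseMonotone _)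
      (fun _ => (geometricWeight_pos _ _).le) (transferIter_nonneg hf n) hreg.1)
    exact mul_le_mul hz hreg.2.2.2.1 (hb.pos n).le (transferIter_nonneg hf n _)

theorem finite_diff_of_Ioo_subset {S : Set ℝ} (h : Ioo α β ⊆ S) : (Icc α β \ S).Finite := by
  refine (Set.toFinite {α, β}).subset ?_
  rintro x ⟨hx, hxS⟩
  rcases hx.1.eq_or_lt with h1 | h1
  · exact Or.inl h1.symm
  rcases hx.2.eq_or_lt with h2 | h2
  · exact Or.inr h2
  · exact (hxS (h ⟨h1, h2⟩)).elim

theorem IsBounded.einf_transferIter_pos (hαβ : α < β) (hb : R.IsBounded σ ω e C)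
    (hd : ∀ j, HasGeometricPotential α β (R.map j)) {J : Set ℝ} (hJ : J ⊆ Icc α β) {n : ℕ}
    (hcov : Ioo α β ⊆ R.iter σ n ω '' J) :
    0 < einf α β (R.transferIter σ (fun j => geometricWeight (R.map j)) n ω (J.indicator 1)) := by
  obtain ⟨E, hE, h⟩ := hb.le_transferIter hd (f := J.indicator 1) (δ := 1)
    (fun x => indicator_nonneg (fun _ _ => zero_le_one) x) hJ
    (fun x hx => by rw [indicator_of_mem hx]; exact le_rfl) n
  rw [one_mul] at h
  refine (Finset.prod_pos fun i _ => hb.pos i).trans_le (le_einf hαβ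
    (ae_leb_of_countable (s := Ioo α β \ E) ?_ fun y hy => h y (hcov hy.1) hy.2))
  refine ((finite_diff_of_Ioo_subset (Subset.refl (Ioo α β))).countable.union hE).mono ?_
  rintro x ⟨hx, hxs⟩
  by_cases hxE : x ∈ E
  · exact Or.inr hxE
  · exact Or.inl ⟨hx, fun h => hxs ⟨h, hxE⟩⟩

/-! ### Growth of intervals -/

theorem isBounded_of_einf_pos (hαβ : α < β)
    (hw : ∀ j, IsWeight α β (geometricWeight (R.map j)))
    (hpos : ∀ i, 0 < einf α β (geometricWeight (R.T (σ^[i] ω)))) :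
    R.IsBounded σ ω (fun i => einf α β (geometricWeight (R.T (σ^[i] ω))))
      (fun i => supNorm α β (geometricWeight (R.T (σ^[i] ω)))) := by
  have hge : ∀ i, ∀ᵐ x ∂leb α β, einf α β (geometricWeight (R.T (σ^[i] ω))) ≤
      geometricWeight (R.T (σ^[i] ω)) x := fun i =>
    ae_einf_le (c := 0) (Filter.Eventually.of_forall fun x => (geometricWeight_pos _ _).le)
  have hle : ∀ i, ∀ᵐ x ∂leb α β, geometricWeight (R.T (σ^[i] ω)) x ≤
      supNorm α β (geometricWeight (R.T (σ^[i] ω))) := fun i => ae_le_supNorm hαβ.le (hw _).2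
  have : (ae (leb α β)).NeBot := ae_neBot.2 (leb_ne_zero hαβ)
  refine ⟨hpos, fun i => ?_, hge, hle⟩
  obtain ⟨x, hx⟩ := (hle i).exists
  exact (geometricWeight_pos _ _).trans_le hx

theorem sum_sub_shift (u : ℕ → ℝ) (n k : ℕ) :
    ∑ l ∈ Finset.range k, (u l - u (l + n)) =
      ∑ l ∈ Finset.range n, u l - ∑ l ∈ Finset.range n, u (k + l) := by
  induction k with
  | zero => simp
  | succ k ih =>
    have h1 := Finset.sum_range_succ (fun l => u (k + l)) n
    have h2 := Finset.sum_range_succ' (fun l => u (k + l)) n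
    have h3 : ∑ l ∈ Finset.range n, u (k + 1 + l) = ∑ l ∈ Finset.range n, u (k + (l + 1)) :=
      Finset.sum_congr rfl fun l _ => by rw [add_assoc, add_comm 1]
    rw [Finset.sum_range_succ, ih, h3]
    simp only [add_zero] at h2
    linarith

/-- If the Birkhoff sums of the logarithm of the contraction coefficient are unbounded below, then
some image of every interval contains the interior of `I`. -/
theorem exists_Ioo_subset_image_iter (hαβ : α < β)
    (hd : ∀ j, HasGeometricPotential α β (R.map j))
    (hw : ∀ j, IsWeight α β (geometricWeight (R.map j)))
    (hpos : ∀ i, 0 < einf α β (geometricWeight (R.T (σ^[i] ω)))) {n : ℕ} (hn : 0 < n)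
    (hS : ¬ BddBelow (range fun k => birkhoffSum σ (fun ω =>
      Real.log (R.contractionCoeff σ (fun j => geometricWeight (R.map j)) n ω)) k ω))
    {a b : ℝ} (hab : a < b) (hJ : Ioo a b ⊆ Icc α β) :
    ∃ M, 0 < M ∧ Ioo α β ⊆ R.iter σ M ω '' Ioo a b := by
  have hb : ∀ l, R.IsBounded σ (σ^[l] ω) _ _ := fun l =>
    isBounded_of_einf_pos hαβ hw fun i => by
      rw [← Function.iterate_add_apply]; exact hpos (i + l)
  have hI : ∀ l, R.iter σ l ω '' Ioo a b ⊆ Icc α β := by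
    rintro l _ ⟨z, hz, rfl⟩
    exact R.iter_mapsTo σ ω l (hJ hz)
  by_contra! hcon
  -- A full branch inside the l-th image would make the (l + n)-th image contain (α, β).
  have hnofull : ∀ l a' b', Ioo a' b' ⊆ R.iter σ l ω '' Ioo a b →
      ∀ W ∈ fullBranches α β (R.iter σ n (σ^[l] ω)) (R.partition σ n (σ^[l] ω)),
        ¬ W ⊆ Ioo a' b' := by
    intro l a' b' hsub W hW hWs
    refine hcon (l + n) (by omega) ?_
    rw [R.iter_add, image_comp]
    exact hW.2.trans (image_mono (hWs.trans hsub))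
  set c : ℕ → ℝ := fun l =>
    R.contractionCoeff σ (fun j => geometricWeight (R.map j)) n (σ^[l] ω)
  set u : ℕ → ℝ := fun l => intervalLength (R.iter σ l ω '' Ioo a b)
  -- The length b - a is at most a multiple of `u l`, so `u l` cannot vanish and its logarithm is
  -- genuine.
  have hu0 : ∀ l, 0 < u l := by
    intro l
    have h := (hb 0).sub_le_ncard_mul hαβ.le hd l hJ
    have hnn : 0 ≤ u l := intervalLength_nonneg hαβ.le (hI l)
    refine lt_of_le_of_ne hnn fun h0 => ?_
    change b - a ≤ _ * (_ * u l) at h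
    rw [← h0] at h
    simp only [mul_zero] at h
    linarith
  have hu1 : ∀ l, u l ≤ β - α := fun l =>
    intervalLength_le fun a' b' h1 h2 =>
      mem_upperBounds_intervalLength hαβ.le (hI l) ⟨a', b', h1, rfl, h2⟩
  have hc0 : ∀ l, 0 < c l := fun l =>
    (mul_pos (Nat.cast_pos.2 (Nat.succ_pos _)) (Finset.prod_pos fun i _ =>
      (hb l).pos' i)).trans_le ((hb l).le_contractionCoeff hαβ hd n)
  have hstep : ∀ l, u l ≤ c l * u (l + n) := by
    intro l
    refine intervalLength_le fun a' b' h1 h2 => ?_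
    refine ((hb l).sub_le_contractionCoeff_mul hαβ hd n (h2.trans (hI l))
      (hnofull l a' b' h2)).trans ?_
    refine mul_le_mul_of_nonneg_left (intervalLength_mono hαβ.le (hI _) ?_) (hc0 l).le
    rw [R.iter_add, image_comp]
    exact image_mono h2
  have hlog : ∀ l, Real.log (u l) - Real.log (u (l + n)) ≤ Real.log (c l) := by
    intro l
    have := Real.log_le_log (hu0 l) (hstep l)
    rw [Real.log_mul (hc0 l).ne' (hu0 _).ne'] at this
    linarith
  -- The lower bound is what remains after telescoping: the initial block of n terms, minus the
  -- final block estimated by u ≤ β - α.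
  refine hS ⟨∑ l ∈ Finset.range n, Real.log (u l) - n * Real.log (β - α), ?_⟩
  rintro _ ⟨k, rfl⟩
  change _ ≤ ∑ l ∈ Finset.range k, Real.log (c l)
  refine le_trans ?_ (Finset.sum_le_sum fun l _ => hlog l)
  rw [sum_sub_shift (fun l => Real.log (u l))]
  have : ∑ l ∈ Finset.range n, Real.log (u (k + l)) ≤ n * Real.log (β - α) := by
    refine (Finset.sum_le_card_nsmul _ _ _ fun l _ =>
      Real.log_le_log (hu0 _) (hu1 _)).trans ?_
    simp
  linarith

/-- Almost every fibre satisfies the hypotheses of `exists_Ioo_subset_image_iter`. -/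
theorem StronglyContracting.ae_exists_Ioo_subset [IsProbabilityMeasure m] (hαβ : α < β)
    (hσ : Ergodic σ m) (hd : ∀ j, HasGeometricPotential α β (R.map j))
    (hcontr : R.StronglyContracting σ (fun j => geometricWeight (R.map j))) :
    ∀ᵐ ω ∂m, (∀ i, 0 < einf α β (geometricWeight (R.T (σ^[i] ω)))) ∧
      ∀ a b : ℝ, α ≤ a → a < b → b ≤ β →
        ∃ M, 0 < M ∧ Ioo α β ⊆ R.iter σ M ω '' Ioo a b := by
  obtain ⟨n, hn, hint⟩ := hcontr.contracting
  have hpos : ∀ᵐ ω ∂m, ∀ i, 0 < einf α β (geometricWeight (R.T (σ^[i] ω))) :=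
    ae_all_iff.2 fun i =>
      (hσ.toMeasurePreserving.iterate i).quasiMeasurePreserving.ae hcontr.einf_pos
  have hi : Integrable (fun ω =>
      Real.log (R.contractionCoeff σ (fun j => geometricWeight (R.map j)) n ω)) m := by
    -- The integral of a non-integrable function is 0 by convention, so a negative integral forces
    -- integrability.
    by_contra h
    rw [integral_undef h] at hint
    exact lt_irrefl _ hint
  filter_upwards [hpos, not_bddBelow_birkhoffSum hσ hi hint] with ω h1 h2
  exact ⟨h1, fun a b ha hab hb => exists_Ioo_subset_image_iter hαβ hd hcontr.isWeight h1 hn h2 hab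
    (Ioo_subset_Icc_self.trans (Icc_subset_Icc ha hb))⟩

end RandomClosedMap

end

end RandomInterval

end

/-- One time M serves both conclusions: once the image of J contains (α, β), it misses at most the
two endpoints of I, and the transferred indicator is bounded below off a countable set. -/
theorem mainTheorem4 {α β : ℝ} (hαβ : α < β)
    {X : Type*} [MetricSpace X] [CompleteSpace X] [TopologicalSpace.SeparableSpace X]
    [MeasurableSpace X] [BorelSpace X] (Ω : Set X) (hΩ : MeasurableSet Ω)
    (m : Measure Ω) [IsProbabilityMeasure m] (σ : Ω ≃ₜ Ω) (hσ : Ergodic σ m)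
    (R : RandomInterval.RandomClosedMap α β m)
    (hdiff : ∀ j, RandomInterval.HasGeometricPotential α β (R.map j))
    (hcontr : R.StronglyContracting σ (fun j => RandomInterval.geometricWeight (R.map j))) :
    R.IsCovering σ (fun j => RandomInterval.geometricWeight (R.map j)) ∧ R.IsImageCovering σ := by
  have h := hcontr.ae_exists_Ioo_subset hαβ hσ hdiff
  constructor
  · filter_upwards [h] with ω hω
    intro a b ha hab hb
    obtain ⟨hpos, hcov⟩ := hω
    obtain ⟨M, hM, hsub⟩ := hcov a b ha hab hb
    exact ⟨M, hM, (RandomInterval.RandomClosedMap.isBounded_of_einf_pos hαβ hcontr.isWeight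
      hpos).einf_transferIter_pos hαβ hdiff
      (Ioo_subset_Icc_self.trans (Icc_subset_Icc ha hb)) hsub⟩
  · filter_upwards [h] with ω hω
    intro a b ha hab hb
    obtain ⟨M, hM, hsub⟩ := hω.2 a b ha hab hb
    exact ⟨M, hM, RandomInterval.RandomClosedMap.finite_diff_of_Ioo_subset hsub⟩
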